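/- **Setting.** Let $n\ge 1$, let $M$ be a free $\mathbb Z$-module of rank $n$, let $N=\operatorname{Hom}(M,\mathbb Z)$, $N_{\mathbb R}=\operatorname{Hom}(M,\mathbb R)$, and let $\langle\cdot,\cdot\rangle\colon M\times N_{\mathbb R}\to\mathbb R$ be the canonical pairing. Let $M'$ be a free $\mathbb Z$-module of rank $n$ embedded in $N_{\mathbb R}$ as a lattice (i.e. $M'_{\mathbb R}\to N_{\mathbb R}$ is an isomorphism). Let $X=N_{\mathbb R}/M'$, with canonical surjection $\pi\colon N_{\mathbb R}\to X$; it is a rational polyhedral space whose charts are the local inverses of $\pi$ followed by linear coordinates $N_{\mathbb R}\cong\mathbb R^n$ that identify $N$ with $\mathbb Z^n$. Put $\mathbb T=\mathbb R\cup\{+\infty\}$. A *tropical descent datum* is a pair $(\lambda,\gamma)$ of a homomorphism $\lambda\colon M'\to M$ and a map $\gamma\colon M'\to\mathbb R$ with $\gamma(u_1+u_2)-\gamma(u_1)-\gamma(u_2)=\langle\lambda(u_2),u_1\rangle$ for all $u_1,u_2\in M'$. The tropical line bundle $L=L(\lambda,\gamma)$ on $X$ is the quotient of $N_{\mathbb R}\times\mathbb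 T$ by the action $u\cdot(x,t)=(x+u,\;t-\langle\lambda(u),x\rangle-\gamma(u))$ of $M'$. Let $Q$ be the symmetric $\mathbb R$-bilinear form on $N_{\mathbb R}$ with $Q(u,x)=\langle\lambda(u),x\rangle$ for $u\in M'$, $x\in N_{\mathbb R}$. The line bundle $L$ is *positive* if $Q$ is positive definite; then $X$ is a tropical abelian variety. It has *type* $(d_1,\dots,d_n)$, where $d_1\mid d_2\mid\cdots\mid d_n$ are positive integers, if $\lambda$ is represented by $\operatorname{diag}(d_1,\dots,d_n)$ in suitable $\mathbb Z$-bases of $M'$ and $M$. Assume that $L$ is positive of type $(d_1,\dots,d_n)$, put $D=d_1\cdots d_n$, and let $b_1,\dots,b_D\in M$ be a complete system of representatives of $M/\lambda(M')$. For $b\in M$ let $$\vartheta_b(x)=\min_{u\in M'}\bigl\{\langle b+\lambda(u),x\rangle+\gamma(u)+\langle b,u\rangle\bigr\}\qquad(x\in N_{\mathbb R}),$$ and let $\bar\vartheta_b$ be the global section of $L$ whose pullback to $N_{\mathbb R}$ is $\vartheta_b$, i.e. $\bar\vartheta_b(\pi(x))=[(x,\vartheta_b(x))]$. Let $\mathbb{TP}^{D-1}=(\mathbb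 T^{D}\setminus\{(+\infty,\dots,+\infty)\})/\mathbb R$, where $\mathbb R$ acts by adding a common constant, with the quotient topology, and let $$\varphi\colon X\to\mathbb{TP}^{D-1},\qquad y\mapsto(\bar\vartheta_{b_1}(y):\cdots:\bar\vartheta_{b_D}(y)).$$ Its image lies in the maximal tropical torus $\mathbb R^{D}/\mathbb R$, which is identified with $\mathbb R^{D-1}$ by $(a_1,\dots,a_{D-1})\mapsto(0:a_1:\cdots:a_{D-1})$. An affine map $x\mapsto Ax+c$ from $\mathbb R^m$ to $\mathbb R^k$ with $A\in\mathbb Z^{k\times m}$ is *unimodular* if $A$ has rank $m$ and $\mathbb Z^k/A\mathbb Z^m$ is torsion-free. The map $\varphi$ is *unimodular* if, for some atlas of $X$ and each of its charts $\alpha_i\colon X_i\to U_i\subseteq\mathbb R^{m}$, there is a (locally finite) rational polyhedral complex $\mathcal C$ in $\mathbb R^{m}$ such that $U_i$ is an open subset of $|\mathcal C|$ and, for every $\sigma\in\mathcal C$, the map $\varphi\circ\alpha_i^{-1}$ coincides on $\sigma\cap U_i$ with a unimodular affine map $\mathbb R^{m}\to\mathbb R^{D-1}$. It is a *faithful embedding*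 if it is unimodular and a homeomorphism onto its image. **Theorem.** 1. If $d_1\ge 3$, then $\varphi$ is a homeomorphism onto its image. 2. If $d_1\ge 2\,(n-1)!$, then $\varphi$ is unimodular. 3. If $d_1\ge\max\{3,\,2\,(n-1)!\}$, then $\varphi$ is a faithful embedding. -/

import Mathlib

open Set Topology

namespace TropicalAbelian

/-! ### Rational polyhedra, polyhedral complexes, integral affine maps -/

/-- The rational polyhedron cut out in `ℝ^m` by finitely many inequalities `⟨v, x⟩ ≥ c`
with `v ∈ ℤ^m` and `c ∈ ℝ`. -/
def polyhedron {m : ℕ} (S : Finset ((Fin m → ℤ) × ℝ)) : Set (Fin m → ℝ) :=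
  {x | ∀ p ∈ S, p.2 ≤ ∑ i, (p.1 i : ℝ) * x i}

def IsRationalPolyhedron {m : ℕ} (σ : Set (Fin m → ℝ)) : Prop :=
  ∃ S : Finset ((Fin m → ℤ) × ℝ), σ = polyhedron S

/-- `τ` is a face of `σ`: it arises by turning some of the inequalities defining `σ` into
equalities. -/
def IsFace {m : ℕ} (τ σ : Set (Fin m → ℝ)) : Prop :=
  ∃ S T : Finset ((Fin m → ℤ) × ℝ), T ⊆ S ∧ σ = polyhedron S ∧
    τ = {x | x ∈ polyhedron S ∧ ∀ p ∈ T, ∑ i, (p.1 i : ℝ) * x i = p.2}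

structure IsRationalPolyhedralComplex {m : ℕ} (C : Set (Set (Fin m → ℝ))) : Prop where
  isRationalPolyhedron : ∀ σ ∈ C, IsRationalPolyhedron σ
  locallyFinite : LocallyFinite (fun σ : C => (σ : Set (Fin m → ℝ)))
  face_mem : ∀ σ ∈ C, ∀ τ, IsFace τ σ → τ ∈ C
  inter_isFace : ∀ σ ∈ C, ∀ σ' ∈ C, (σ ∩ σ').Nonempty → IsFace (σ ∩ σ') σ ∧ IsFace (σ ∩ σ') σ'

/-- `U` is an open subset (for the subspace topology) of the subset `Y`. -/
def IsOpenSubsetOf {m : ℕ} (U Y : Set (Fin m → ℝ)) : Prop :=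
  ∃ O : Set (Fin m → ℝ), IsOpen O ∧ U = O ∩ Y

/-- Open subsets of the underlying set of a rational polyhedral complex. -/
def IsOpenRationalPolyhedralSet {m : ℕ} (U : Set (Fin m → ℝ)) : Prop :=
  ∃ C : Set (Set (Fin m → ℝ)), IsRationalPolyhedralComplex C ∧ IsOpenSubsetOf U (⋃₀ C)

/-- The affine map `x ↦ A x + c` with integral linear part `A`. -/
def affineMap {m k : ℕ} (A : Matrix (Fin k) (Fin m) ℤ) (c : Fin k → ℝ) (x : Fin m → ℝ) :
    Fin k → ℝ :=
  (A.map (Int.cast : ℤ → ℝ)).mulVec x + c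

def IsIntegralAffine {m k : ℕ} (F : (Fin m → ℝ) → (Fin k → ℝ)) : Prop :=
  ∃ (A : Matrix (Fin k) (Fin m) ℤ) (c : Fin k → ℝ), F = affineMap A c

/-- An integral `k × m` matrix is unimodular if it has rank `m` and `ℤ^k / A ℤ^m` is
torsion-free. -/
def IsUnimodularMatrix {m k : ℕ} (A : Matrix (Fin k) (Fin m) ℤ) : Prop :=
  A.rank = m ∧ Module.IsTorsionFree ℤ ((Fin k → ℤ) ⧸ LinearMap.range A.mulVecLin)

def IsUnimodularAffine {m k : ℕ} (F : (Fin m → ℝ) → (Fin k → ℝ)) : Prop :=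
  ∃ (A : Matrix (Fin k) (Fin m) ℤ) (c : Fin k → ℝ), IsUnimodularMatrix A ∧ F = affineMap A c

/-- A map on an open rational polyhedral set `U ⊆ ℝ^m` that is locally integral affine. -/
def IsTropicalMorphism {m k : ℕ} {U : Set (Fin m → ℝ)} (f : U → (Fin k → ℝ)) : Prop :=
  ∀ p : U, ∃ F : (Fin m → ℝ) → (Fin k → ℝ), IsIntegralAffine F ∧ ∀ᶠ x in 𝓝 p, f x = F x

/-- A map on an open rational polyhedral set `U ⊆ ℝ^m` is unimodular if it is given by unimodular
integral affine maps on the cells of some rational polyhedral complex in whose underlying set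
`U` is open. -/
def IsUnimodularOn {m k : ℕ} {U : Set (Fin m → ℝ)} (f : U → (Fin k → ℝ)) : Prop :=
  ∃ C : Set (Set (Fin m → ℝ)), IsRationalPolyhedralComplex C ∧ IsOpenSubsetOf U (⋃₀ C) ∧
    ∀ σ ∈ C, ∃ F : (Fin m → ℝ) → (Fin k → ℝ), IsUnimodularAffine F ∧
      ∀ x : U, (x : Fin m → ℝ) ∈ σ → f x = F x

/-- Every open subset of `ℝ^m` is an open rational polyhedral set. -/
theorem isOpenRationalPolyhedralSet_of_isOpen {m : ℕ} {U : Set (Fin m → ℝ)} (hU : IsOpen U) :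
    IsOpenRationalPolyhedralSet U := by
  have hpu : IsRationalPolyhedron (univ : Set (Fin m → ℝ)) := ⟨∅, by simp [polyhedron]⟩
  have hpe : IsRationalPolyhedron (∅ : Set (Fin m → ℝ)) :=
    ⟨{(0, 1)}, by ext x; simp [polyhedron]⟩
  have huu : IsFace (univ : Set (Fin m → ℝ)) univ := ⟨∅, ∅, by simp, by simp [polyhedron],
    by simp [polyhedron]⟩
  refine ⟨{univ, ∅}, ⟨?_, ?_, ?_, ?_⟩, U, hU, by simp⟩
  · rintro σ (rfl | rfl)
    exacts [hpu, hpe]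
  · have : Finite ({univ, ∅} : Set (Set (Fin m → ℝ))) := Set.toFinite _
    exact locallyFinite_of_finite _
  · rintro σ hσ τ ⟨S, R, hR, h1, h2⟩
    by_cases hne : τ.Nonempty
    · left
      obtain ⟨x₀, hx₀⟩ := hne
      have hσu : σ = univ := by
        rcases hσ with rfl | rfl
        · rfl
        · rw [h2] at hx₀
          have := h1 ▸ hx₀.1
          exact this.elim
      rw [h2] at hx₀ ⊢
      refine eq_univ_of_forall fun x => ?_
      have hall : ∀ y, y ∈ polyhedron S := fun y => by rw [← h1, hσu]; trivial
      refine ⟨hall x, fun p hp => ?_⟩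
      have e1 := hx₀.2 p hp
      have e2 := hall x p (hR hp)
      have e3 := hall (2 • x₀ - x) p (hR hp)
      have e4 : ∑ i, (p.1 i : ℝ) * (2 • x₀ - x) i
          = 2 * ∑ i, (p.1 i : ℝ) * x₀ i - ∑ i, (p.1 i : ℝ) * x i := by
        rw [Finset.mul_sum, ← Finset.sum_sub_distrib]
        refine Finset.sum_congr rfl fun i _ => ?_
        simp
        ring
      rw [e4] at e3
      linarith
    · right
      exact not_nonempty_iff_eq_empty.1 hne
  · rintro σ (rfl | rfl) σ' (rfl | rfl) h
    · simpa using huu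
    all_goals simp at h

/-! ### Rational polyhedral spaces -/

/-- A chart of `X`: a homeomorphism `α` from an open subset `source` of `X` onto an open rational
polyhedral set `range coord` in `ℝ^dim`. -/
structure PolyhedralChart (X : Type*) [TopologicalSpace X] where
  dim : ℕ
  source : Set X
  isOpen_source : IsOpen source
  coord : source → (Fin dim → ℝ)
  isEmbedding : IsEmbedding coord
  isOpenRationalPolyhedralSet : IsOpenRationalPolyhedralSet (range coord)

namespace PolyhedralChart

variable {X : Type*} [TopologicalSpace X]

def target (c : PolyhedralChart X) : Set (Fin c.dim → ℝ) := range c.coord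

noncomputable def homeo (c : PolyhedralChart X) : c.source ≃ₜ c.target :=
  c.isEmbedding.toHomeomorph

/-- The part of the target of `c` that corresponds to the overlap with `c'`. -/
def overlap (c c' : PolyhedralChart X) : Set (Fin c.dim → ℝ) :=
  {y | ∃ h : y ∈ c.target, (c.homeo.symm ⟨y, h⟩ : X) ∈ c'.source}

/-- The transition map from the chart `c` to the chart `c'`. -/
noncomputable def transition (c c' : PolyhedralChart X) (y : c.overlap c') : Fin c'.dim → ℝ :=
  c'.coord ⟨c.homeo.symm ⟨y, y.2.1⟩, y.2.2⟩

end PolyhedralChart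

structure IsRationalPolyhedralAtlas {X : Type*} [TopologicalSpace X]
    (A : Set (PolyhedralChart X)) : Prop where
  cover : ∀ x : X, ∃ c ∈ A, x ∈ c.source
  transition : ∀ c ∈ A, ∀ c' ∈ A, IsTropicalMorphism (c.transition c')

/-- A rational polyhedral space: a Hausdorff space with (a representative of) an equivalence class
of rational polyhedral atlases. -/
class RationalPolyhedralSpace (X : Type*) [TopologicalSpace X] extends T2Space X where
  atlas : Set (PolyhedralChart X)
  isAtlas : IsRationalPolyhedralAtlas atlas

/-- `A` is an atlas of the rational polyhedral space `X`, i.e. it belongs to the equivalence class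
that defines the structure of `X`. -/
def IsAtlasOf (X : Type*) [TopologicalSpace X] [RationalPolyhedralSpace X]
    (A : Set (PolyhedralChart X)) : Prop :=
  IsRationalPolyhedralAtlas A ∧
    IsRationalPolyhedralAtlas (A ∪ RationalPolyhedralSpace.atlas (X := X))

/-- Unimodular maps from a rational polyhedral space to `ℝ^k`. -/
def IsUnimodularMap {X : Type*} [TopologicalSpace X] [RationalPolyhedralSpace X] {k : ℕ}
    (φ : X → (Fin k → ℝ)) : Prop :=
  ∃ A : Set (PolyhedralChart X), IsAtlasOf X A ∧
    ∀ c ∈ A, IsUnimodularOn (fun y : c.target => φ (c.homeo.symm y))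

/-! ### Tropical projective space

The tropical semifield `𝕋 = ℝ ∪ {+∞}` is `WithTop ℝ`, with its order topology. -/

/-- `𝕋^{N+1} ∖ {(+∞, …, +∞)}`. -/
abbrev HomogeneousCoord (N : ℕ) : Type := {a : Fin (N + 1) → WithTop ℝ // ∃ i, a i ≠ ⊤}

def tropicalProjectiveSetoid (N : ℕ) : Setoid (HomogeneousCoord N) where
  r a b := ∃ c : ℝ, ∀ i, b.1 i = (c : WithTop ℝ) + a.1 i
  iseqv :=
    { refl := fun a => ⟨0, fun i => by simp⟩
      symm := by
        rintro a b ⟨c, h⟩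
        refine ⟨-c, fun i => ?_⟩
        rw [h i, ← add_assoc, ← WithTop.coe_add]
        simp
      trans := by
        rintro a b e ⟨c, h⟩ ⟨c', h'⟩
        refine ⟨c' + c, fun i => ?_⟩
        rw [h' i, h i, WithTop.coe_add, add_assoc] }

/-- The tropical projective space `𝕋ℙ^N`, with the quotient topology. -/
def TropicalProjectiveSpace (N : ℕ) : Type := Quotient (tropicalProjectiveSetoid N)

instance (N : ℕ) : TopologicalSpace (TropicalProjectiveSpace N) :=
  inferInstanceAs (TopologicalSpace (Quotient (tropicalProjectiveSetoid N)))

namespace TropicalProjectiveSpace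

def mk {N : ℕ} (a : HomogeneousCoord N) : TropicalProjectiveSpace N :=
  Quotient.mk (tropicalProjectiveSetoid N) a

/-- The map `(a₁, …, a_N) ↦ (0 : a₁ : ⋯ : a_N)`, which identifies `ℝ^N` with the maximal tropical
torus of `𝕋ℙ^N`. -/
def ofAffine {N : ℕ} (a : Fin N → ℝ) : TropicalProjectiveSpace N :=
  mk ⟨fun i => ((Fin.cons 0 a : Fin (N + 1) → ℝ) i : WithTop ℝ), 0, WithTop.coe_ne_top⟩

end TropicalProjectiveSpace

/-- A map to `𝕋ℙ^N` is unimodular if its image lies in the maximal tropical torus `≅ ℝ^N` and it is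
unimodular as a map to `ℝ^N`. -/
def IsTropicallyUnimodular {X : Type*} [TopologicalSpace X] [RationalPolyhedralSpace X] {N : ℕ}
    (φ : X → TropicalProjectiveSpace N) : Prop :=
  ∃ g : X → (Fin N → ℝ), (∀ x, φ x = TropicalProjectiveSpace.ofAffine (g x)) ∧ IsUnimodularMap g

/-- A faithful embedding: unimodular and a homeomorphism onto its image. -/
def IsFaithfulEmbedding {X : Type*} [TopologicalSpace X] [RationalPolyhedralSpace X] {N : ℕ}
    (φ : X → TropicalProjectiveSpace N) : Prop :=
  IsTropicallyUnimodular φ ∧ IsEmbedding φ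

/-! ### Real tori with an integral structure -/

/-- `N_ℝ = Hom(M, ℝ) = N ⊗ ℝ`, where `N = Hom(M, ℤ)`. -/
abbrev NR (M : Type*) [AddCommGroup M] : Type _ := M →ₗ[ℤ] ℝ

section NR

variable {M : Type*} [AddCommGroup M]

/-- The topology of pointwise convergence; for `M` of finite rank this is the Euclidean topology of
the finite-dimensional space `N_ℝ`. -/
instance : TopologicalSpace (NR M) := TopologicalSpace.induced (fun x : NR M => (x : M → ℝ)) inferInstance

theorem isInducing_coe : IsInducing (fun x : NR M => (x : M → ℝ)) := ⟨rfl⟩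

theorem continuous_eval (m : M) : Continuous (fun x : NR M => x m) :=
  (continuous_apply m).comp isInducing_coe.continuous

theorem continuous_NR {Y : Type*} [TopologicalSpace Y] {f : Y → NR M}
    (h : ∀ m, Continuous fun y => f y m) : Continuous f :=
  isInducing_coe.continuous_iff.2 (continuous_pi h)

instance : IsTopologicalAddGroup (NR M) where
  continuous_add := continuous_NR fun m =>
    ((continuous_eval m).comp continuous_fst).add ((continuous_eval m).comp continuous_snd)
  continuous_neg := continuous_NR fun m => (continuous_eval m).neg

instance : ContinuousSMul ℝ (NR M) where
  continuous_smul := continuous_NR fun m =>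
    continuous_fst.mul ((continuous_eval m).comp continuous_snd)

instance : T2Space (NR M) :=
  T2Space.of_injective_continuous DFunLike.coe_injective isInducing_coe.continuous

/-- The coordinates on `N_ℝ` dual to a basis `B` of `M`: the lattice `N` corresponds to `ℤ^n`. -/
noncomputable def coordHomeo {n : ℕ} (B : Module.Basis (Fin n) ℤ M) : NR M ≃ₜ (Fin n → ℝ) where
  toFun x i := x (B i)
  invFun v := B.constr ℤ v
  left_inv x := B.ext fun i => by simp
  right_inv v := by ext i; simp
  continuous_toFun := continuous_pi fun i => continuous_eval (B i)
  continuous_invFun := continuous_NR fun m => by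
    simp only [Module.Basis.constr_apply_fintype]
    fun_prop

theorem coordHomeo_symm_add {n n' : ℕ} (B : Module.Basis (Fin n) ℤ M)
    (B' : Module.Basis (Fin n') ℤ M) (v : Fin n → ℝ) (a : NR M) :
    coordHomeo B' ((coordHomeo B).symm v + a) =
      affineMap (Matrix.of fun j i => B.repr (B' j) i) (coordHomeo B' a) v := by
  ext j
  simp [coordHomeo, affineMap, Matrix.mulVec, dotProduct, Module.Basis.constr_apply_fintype]

end NR

/-- The data of a real torus with an integral structure: free `ℤ`-modules `M`, `M'` of finite rank
and a homomorphism `M' → N_ℝ` that induces an isomorphism `M'_ℝ ≅ N_ℝ`. -/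
structure RealTorus (M M' : Type*) [AddCommGroup M] [AddCommGroup M'] where
  incl : M' →ₗ[ℤ] NR M
  isBaseChange : IsBaseChange ℝ incl

namespace RealTorus

variable {M M' : Type*} [AddCommGroup M] [AddCommGroup M'] (T : RealTorus M M')

/-- The image of `M'` in `N_ℝ`. -/
def lattice : AddSubgroup (NR M) := (LinearMap.range T.incl).toAddSubgroup

theorem incl_mem (u : M') : T.incl u ∈ T.lattice := ⟨u, rfl⟩

/-- The real torus `X = N_ℝ / M'`, with the quotient topology. -/
abbrev Space : Type _ := NR M ⧸ T.lattice

/-- The canonical surjection `π : N_ℝ → X`. -/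
def proj (x : NR M) : T.Space := QuotientAddGroup.mk x

theorem proj_eq_iff {x y : NR M} : T.proj x = T.proj y ↔ ∃ u : M', y = x + T.incl u := by
  unfold proj
  rw [QuotientAddGroup.eq]
  constructor
  · rintro ⟨u, hu⟩
    exact ⟨u, by rw [hu]; abel⟩
  · rintro ⟨u, rfl⟩
    exact ⟨u, by abel⟩

theorem proj_surjective : Function.Surjective T.proj := QuotientAddGroup.mk_surjective

theorem continuous_proj : Continuous T.proj := continuous_quotient_mk'

theorem isOpenMap_proj : IsOpenMap T.proj := QuotientAddGroup.isOpenMap_coe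

section Chart

variable {T}

theorem isOpenEmbedding_proj {V : Set (NR M)} (hV : IsOpen V) (hinj : InjOn T.proj V) :
    IsOpenEmbedding (fun v : V => T.proj v) :=
  .of_continuous_injective_isOpenMap (T.continuous_proj.comp continuous_subtype_val)
    (fun x y h => Subtype.ext (hinj x.2 y.2 h))
    (T.isOpenMap_proj.comp hV.isOpenMap_subtype_val)

/-- The inverse of `π : V → π(V)`, for `V ⊆ N_ℝ` open and such that `π` is injective on `V`. -/
noncomputable def localSection {V : Set (NR M)} (hV : IsOpen V) (hinj : InjOn T.proj V) :
    range (fun v : V => T.proj v) ≃ₜ V :=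
  (isOpenEmbedding_proj hV hinj).isEmbedding.toHomeomorph.symm

theorem proj_localSection {V : Set (NR M)} (hV : IsOpen V) (hinj : InjOn T.proj V)
    (y : range (fun v : V => T.proj v)) : T.proj (localSection hV hinj y) = y := by
  have := (isOpenEmbedding_proj hV hinj).isEmbedding.toHomeomorph.apply_symm_apply y
  exact congrArg Subtype.val this

/-- The chart of `X = N_ℝ / M'` given by a local inverse of `π : N_ℝ → X`, defined on `π(V)`,
followed by the coordinates of `N_ℝ` with respect to a basis of `N`. -/
noncomputable def chart {n : ℕ} (B : Module.Basis (Fin n) ℤ M) {V : Set (NR M)} (hV : IsOpen V)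
    (hinj : InjOn T.proj V) : PolyhedralChart T.Space where
  dim := n
  source := range (fun v : V => T.proj v)
  isOpen_source := (isOpenEmbedding_proj hV hinj).isOpen_range
  coord y := coordHomeo B (localSection hV hinj y)
  isEmbedding := (coordHomeo B).isEmbedding.comp
    (IsEmbedding.subtypeVal.comp (localSection hV hinj).isEmbedding)
  isOpenRationalPolyhedralSet := isOpenRationalPolyhedralSet_of_isOpen
    ((coordHomeo B).isOpenEmbedding.comp
      (hV.isOpenEmbedding_subtypeVal.comp (localSection hV hinj).isOpenEmbedding)).isOpen_range

end Chart

/-- The canonical atlas of `X`. -/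
def canonicalAtlas : Set (PolyhedralChart T.Space) :=
  {c | ∃ (n : ℕ) (B : Module.Basis (Fin n) ℤ M) (V : Set (NR M)) (hV : IsOpen V)
    (hinj : InjOn T.proj V), c = chart B hV hinj}

variable [Module.Free ℤ M'] [Module.Finite ℤ M']

theorem exists_eval_eq_int :
    ∃ f : NR M →ₗ[ℝ] (Module.Free.ChooseBasisIndex ℤ M' → ℝ), Function.Injective f ∧
      Continuous f ∧ ∀ x, x ∈ T.lattice ↔ ∀ i, f x i ∈ range (Int.cast : ℤ → ℝ) := by
  let b := Module.Free.chooseBasis ℤ M'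
  let bR := T.isBaseChange.basis b
  have : FiniteDimensional ℝ (NR M) := Module.Finite.of_basis bR
  refine ⟨bR.equivFun.toLinearMap, bR.equivFun.injective,
    LinearMap.continuous_of_finiteDimensional _, fun x => ⟨?_, fun h => ?_⟩⟩
  · rintro ⟨u, rfl⟩ i
    refine ⟨b.repr u i, ?_⟩
    simp [bR, IsBaseChange.basis_repr_comp_apply]
  · choose k hk using h
    refine ⟨∑ i, k i • b i, ?_⟩
    apply bR.equivFun.injective
    ext i
    have := hk i
    simp only [LinearEquiv.coe_coe] at this
    rw [← this]
    simp [bR, IsBaseChange.basis_repr_comp_apply, Finsupp.single_apply]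

theorem incl_injective : Function.Injective T.incl := by
  intro u v h
  refine (Module.Free.chooseBasis ℤ M').ext_elem fun i => ?_
  have h1 := T.isBaseChange.basis_repr_comp_apply (Module.Free.chooseBasis ℤ M') u i
  have h2 := T.isBaseChange.basis_repr_comp_apply (Module.Free.chooseBasis ℤ M') v i
  rw [h, h2] at h1
  exact (Int.cast_injective (α := ℝ) h1).symm

theorem isClosed_lattice : IsClosed (T.lattice : Set (NR M)) := by
  obtain ⟨f, -, hf, h⟩ := T.exists_eval_eq_int
  have : (T.lattice : Set (NR M)) = ⋂ i, (fun x => f x i) ⁻¹' range (Int.cast : ℤ → ℝ) := by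
    ext x
    simpa using h x
  rw [this]
  exact isClosed_iInter fun i => Int.isClosedEmbedding_coe_real.isClosed_range.preimage
    ((continuous_apply i).comp hf)

instance : T2Space T.Space := by
  have : IsClosed (T.lattice : Set (NR M)) := T.isClosed_lattice
  infer_instance

theorem exists_injOn_proj (x : NR M) : ∃ V : Set (NR M), IsOpen V ∧ x ∈ V ∧ InjOn T.proj V := by
  obtain ⟨f, hinj, hf, h⟩ := T.exists_eval_eq_int
  refine ⟨⋂ i, {y | |f y i - f x i| < 1 / 2}, isOpen_iInter_of_finite fun i => ?_, by simp, ?_⟩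
  · exact isOpen_lt (((continuous_apply i).comp hf).sub continuous_const).abs continuous_const
  · intro y hy z hz hyz
    obtain ⟨u, rfl⟩ := T.proj_eq_iff.1 hyz
    have h0 : f (T.incl u) = 0 := by
      ext i
      obtain ⟨k, hk⟩ := (h _).1 (T.incl_mem u) i
      have h1 := mem_iInter.1 hy i
      have h2 := mem_iInter.1 hz i
      simp only [mem_ofPred_eq, map_add, Pi.add_apply, abs_lt] at h1 h2
      rw [← hk] at h2
      have h3 : (k : ℝ) < 1 := by linarith
      have h4 : (-1 : ℝ) < k := by linarith
      have h5 : k = 0 := by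
        have : k < 1 := by exact_mod_cast h3
        have : -1 < k := by exact_mod_cast h4
        omega
      simp [← hk, h5]
    rw [hinj (h0.trans (map_zero f).symm), add_zero]

theorem isTropicalMorphism_transition {n n' : ℕ} (B : Module.Basis (Fin n) ℤ M)
    (B' : Module.Basis (Fin n') ℤ M) {V V' : Set (NR M)} (hV : IsOpen V) (hV' : IsOpen V')
    (hinj : InjOn T.proj V) (hinj' : InjOn T.proj V') :
    IsTropicalMorphism ((chart B hV hinj).transition (chart B' hV' hinj')) := by
  let c := chart B hV hinj
  let c' := chart B' hV' hinj'
  have key1 : ∀ y : c.target, (c.homeo.symm y : T.Space) = T.proj ((coordHomeo B).symm y.1) := by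
    intro y
    have h1 : (c.homeo (c.homeo.symm y)).1 = y.1 := by rw [c.homeo.apply_symm_apply]
    have h2 : coordHomeo B (localSection hV hinj (c.homeo.symm y)) = y.1 := h1
    refine (proj_localSection hV hinj (c.homeo.symm y)).symm.trans ?_
    exact congrArg T.proj ((coordHomeo B).symm_apply_eq.2 h2.symm).symm
  have key2 : ∀ (z : NR M) (hz : z ∈ V') (h : T.proj z ∈ c'.source),
      c'.coord ⟨T.proj z, h⟩ = coordHomeo B' z := by
    intro z hz h
    change coordHomeo B' (localSection hV' hinj' ⟨T.proj z, h⟩) = _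
    congr 1
    exact hinj' (localSection hV' hinj' ⟨T.proj z, h⟩).2 hz (proj_localSection hV' hinj' _)
  have key3 : ∀ (y : c.overlap c') (z : NR M), z ∈ V' →
      T.proj ((coordHomeo B).symm y.1) = T.proj z → c.transition c' y = coordHomeo B' z := by
    intro y z hz h
    have e : (c.homeo.symm ⟨y.1, y.2.1⟩ : T.Space) = T.proj z := (key1 _).trans h
    have hs : T.proj z ∈ c'.source := e ▸ y.2.2
    rw [← key2 z hz hs]
    unfold PolyhedralChart.transition
    congr 1
    exact Subtype.ext e
  intro p
  obtain ⟨w, hw⟩ : T.proj ((coordHomeo B).symm p.1) ∈ c'.source :=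
    (key1 ⟨p.1, p.2.1⟩) ▸ p.2.2
  obtain ⟨u, hu⟩ := T.proj_eq_iff.1 hw.symm
  refine ⟨_, ⟨Matrix.of fun j i => B.repr (B' j) i, coordHomeo B' (T.incl u), rfl⟩, ?_⟩
  let O : Set (Fin n → ℝ) := c.overlap c'
  have hcont : Continuous fun y : O => (coordHomeo B).symm y.1 + T.incl u :=
    ((coordHomeo B).symm.continuous.comp continuous_subtype_val).add continuous_const
  have hev : ∀ᶠ y : O in 𝓝 (show O from p), (coordHomeo B).symm y.1 + T.incl u ∈ V' :=
    hcont.continuousAt.eventually_mem (hV'.mem_nhds (hu ▸ w.2))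
  filter_upwards [hev] with y hy
  exact (key3 y _ hy (T.proj_eq_iff.2 ⟨u, rfl⟩)).trans (coordHomeo_symm_add B B' y.1 (T.incl u))

variable [Module.Free ℤ M] [Module.Finite ℤ M]

/-- The real torus `X = N_ℝ / M'` as a rational polyhedral space, with the structure for which
`π : N_ℝ → X` is a local isomorphism. -/
instance : RationalPolyhedralSpace T.Space where
  atlas := T.canonicalAtlas
  isAtlas :=
    { cover := by
        intro y
        obtain ⟨x, rfl⟩ := T.proj_surjective y
        obtain ⟨V, hV, hx, hinj⟩ := T.exists_injOn_proj x
        exact ⟨_, ⟨_, Module.finBasis ℤ M, V, hV, hinj, rfl⟩, ⟨⟨x, hx⟩, rfl⟩⟩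
      transition := by
        rintro _ ⟨n, B, V, hV, hinj, rfl⟩ _ ⟨n', B', V', hV', hinj', rfl⟩
        exact T.isTropicalMorphism_transition B B' hV hV' hinj hinj' }

end RealTorus

/-! ### Tropical descent data, line bundles and theta functions -/

section Datum

variable {M M' : Type*} [AddCommGroup M] [AddCommGroup M']

/-- A tropical descent datum `(λ, γ)` for the torus `N_ℝ / M'`. -/
structure TropicalDescentDatum (T : RealTorus M M') where
  lam : M' →ₗ[ℤ] M
  gam : M' → ℝ
  cocycle : ∀ u₁ u₂ : M', gam (u₁ + u₂) - gam u₁ - gam u₂ = T.incl u₁ (lam u₂)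

namespace TropicalDescentDatum

variable {T : RealTorus M M'} (D : TropicalDescentDatum T)

/-- The `ℝ`-bilinear form `Q` on `N_ℝ` with `Q(u', x) = ⟨λ(u'), x⟩` for `u' ∈ M'`, `x ∈ N_ℝ`. -/
noncomputable def form : NR M →ₗ[ℝ] NR M →ₗ[ℝ] ℝ :=
  T.isBaseChange.lift
    { toFun := fun u =>
        { toFun := fun x => x (D.lam u)
          map_add' := fun _ _ => rfl
          map_smul' := fun _ _ => rfl }
      map_add' := fun u v => by ext x; simp
      map_smul' := fun k u => by ext x; simp }

theorem form_incl (u : M') (x : NR M) : D.form (T.incl u) x = x (D.lam u) := by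
  unfold form
  rw [IsBaseChange.lift_eq]
  rfl

/-- `λ` is a polarization, i.e. the tropical line bundle `L(λ, γ)` is positive. -/
def IsPolarization : Prop := ∀ x : NR M, x ≠ 0 → 0 < D.form x x

/-- `λ` has type `(d₁, …, d_n)`. -/
def HasType {n : ℕ} (d : Fin n → ℕ) : Prop :=
  (∀ i, 0 < d i) ∧ (∀ i j, i ≤ j → d i ∣ d j) ∧
    ∃ (B' : Module.Basis (Fin n) ℤ M') (B : Module.Basis (Fin n) ℤ M),
      ∀ i, D.lam (B' i) = d i • B i

/-- The terms of the minimum defining the theta function `ϑ_b`. -/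
def thetaTerm (b : M) (x : NR M) (u : M') : ℝ := x (b + D.lam u) + D.gam u + T.incl u b

/-- The tropical theta function
`ϑ_b(x) = min_{u' ∈ M'} (⟨b + λ(u'), x⟩ + γ(u') + ⟨b, u'⟩)`. -/
noncomputable def theta (b : M) (x : NR M) : ℝ := ⨅ u : M', D.thetaTerm b x u

/-- The factor of automorphy `-⟨λ(u'), x⟩ - γ(u')`. -/
def factor (u : M') (x : NR M) : ℝ := -x (D.lam u) - D.gam u

theorem factor_zero (x : NR M) : D.factor 0 x = 0 := by
  have := D.cocycle 0 0
  simp at this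
  simp [factor, this]

theorem factor_add (u v : M') (x : NR M) :
    D.factor (u + v) x = D.factor u x + D.factor v (x + T.incl u) := by
  have := D.cocycle u v
  simp only [factor, map_add, LinearMap.add_apply]
  linarith

theorem thetaTerm_add_incl (b : M) (x : NR M) (u v : M') :
    D.thetaTerm b (x + T.incl u) v = D.thetaTerm b x (u + v) + D.factor u x := by
  have := D.cocycle u v
  simp only [thetaTerm, factor, map_add, LinearMap.add_apply]
  linarith

variable {D} in
theorem IsPolarization.bddBelow [Module.Free ℤ M'] [Module.Finite ℤ M'] (hD : D.IsPolarization)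
    (b : M) (x : NR M) : BddBelow (range (D.thetaTerm b x)) := by
  have : FiniteDimensional ℝ (NR M) :=
    Module.Finite.of_basis (T.isBaseChange.basis (Module.Free.chooseBasis ℤ M'))
  let L : M' →+ ℝ :=
    AddMonoidHom.mk' (fun u => x (D.lam u) + T.incl u b
      + (D.gam u - 1 / 2 * T.incl u (D.lam u))) fun u v => by
        have h1 := D.cocycle u v
        have h2 := D.cocycle v u
        rw [add_comm v u] at h2
        simp only [map_add, LinearMap.add_apply]
        linarith
  let Lr : NR M →ₗ[ℝ] ℝ := T.isBaseChange.lift L.toIntLinearMap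
  have hLr : ∀ u, Lr (T.incl u) = L u := fun u => T.isBaseChange.lift_eq _ u
  let S : NR M →ₗ[ℝ] NR M →ₗ[ℝ] ℝ := D.form + D.form.flip
  have hS : Function.Injective S := by
    rw [injective_iff_map_eq_zero]
    intro y hy
    by_contra hne
    have h1 := hD y hne
    have h2 : D.form y y + D.form y y = 0 := LinearMap.congr_fun hy y
    linarith
  have hS' : Function.Surjective S :=
    (LinearMap.injective_iff_surjective_of_finrank_eq_finrank
      (Subspace.dual_finrank_eq (K := ℝ) (V := NR M)).symm).1 hS
  obtain ⟨r, hr⟩ := hS' ((2 : ℝ) • Lr)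
  refine ⟨x b - 1 / 2 * D.form r r, ?_⟩
  rintro _ ⟨u, rfl⟩
  have h1 : D.form r (T.incl u) + D.form (T.incl u) r = 2 * L u := by
    rw [← hLr]
    exact LinearMap.congr_fun hr (T.incl u)
  have h2 : 0 ≤ D.form (T.incl u + r) (T.incl u + r) := by
    by_cases h0 : T.incl u + r = 0
    · simp [h0]
    · exact (hD _ h0).le
  have h3 : L u = x (D.lam u) + T.incl u b + (D.gam u - 1 / 2 * T.incl u (D.lam u)) := rfl
  have h4 := D.form_incl u (T.incl u)
  simp only [map_add, LinearMap.add_apply] at h2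
  simp only [thetaTerm, map_add]
  linarith

variable {D} in
/-- Quasi-periodicity of the theta functions. -/
theorem IsPolarization.theta_add_incl [Module.Free ℤ M'] [Module.Finite ℤ M']
    (hD : D.IsPolarization) (b : M) (x : NR M) (u : M') :
    D.theta b (x + T.incl u) = D.theta b x + D.factor u x := by
  unfold theta
  rw [ciInf_add (hD.bddBelow b x)]
  simp only [thetaTerm_add_incl]
  exact (Equiv.addLeft u).iInf_comp (g := fun v => D.thetaTerm b x v + D.factor u x)

/-- The equivalence relation on `N_ℝ × 𝕋` given by the orbits of the action
`u' · (x, t) = (x + u', t - ⟨λ(u'), x⟩ - γ(u'))` of `M'`. -/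
def orbitSetoid : Setoid (NR M × WithTop ℝ) where
  r p q := ∃ u : M', q = (p.1 + T.incl u, p.2 + (D.factor u p.1 : WithTop ℝ))
  iseqv :=
    { refl := fun p => ⟨0, by simp [factor_zero]⟩
      symm := by
        rintro p _ ⟨u, rfl⟩
        refine ⟨-u, Prod.ext (by simp) ?_⟩
        have := D.factor_add u (-u) p.1
        rw [add_neg_cancel, factor_zero] at this
        simp only
        rw [add_assoc, ← WithTop.coe_add, ← this]
        simp
      trans := by
        rintro p _ _ ⟨u, rfl⟩ ⟨v, rfl⟩
        refine ⟨u + v, Prod.ext (by simp [add_assoc]) ?_⟩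
        simp only
        rw [factor_add, WithTop.coe_add, add_assoc] }

/-- The total space of the tropical line bundle `L(λ, γ) = (N_ℝ × 𝕋) / M'` on `X = N_ℝ / M'`. -/
def LineBundle : Type _ := Quotient D.orbitSetoid

def LineBundle.mk (x : NR M) (t : WithTop ℝ) : D.LineBundle := Quotient.mk D.orbitSetoid (x, t)

/-- The bundle projection `L(λ, γ) → X`. -/
def LineBundle.toBase : D.LineBundle → T.Space :=
  Quotient.lift (fun p => T.proj p.1) (by
    rintro p _ ⟨u, rfl⟩
    exact T.proj_eq_iff.2 ⟨u, rfl⟩)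

/-- Global sections of the line bundle `L(λ, γ)`. -/
structure GlobalSection where
  toFun : T.Space → D.LineBundle
  toBase_toFun : ∀ y, LineBundle.toBase D (toFun y) = y

namespace LineBundle

theorem mk_add_incl (x : NR M) (t : WithTop ℝ) (u : M') :
    mk D (x + T.incl u) (t + (D.factor u x : WithTop ℝ)) = mk D x t :=
  (Quotient.sound (s := D.orbitSetoid) (a := (x, t)) ⟨u, rfl⟩).symm

theorem mk_injective [Module.Free ℤ M'] [Module.Finite ℤ M'] (x : NR M) :
    Function.Injective (mk D x) := by
  intro t t' h
  obtain ⟨u, hu⟩ := Quotient.exact (s := D.orbitSetoid) h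
  have h1 : x = x + T.incl u := congrArg Prod.fst hu
  have h2 : t' = t + (D.factor u x : WithTop ℝ) := congrArg Prod.snd hu
  have h3 : u = 0 := T.incl_injective (by rw [map_zero]; exact left_eq_add.1 h1)
  rw [h2, h3, factor_zero]
  simp

end LineBundle

namespace GlobalSection

variable {D}

theorem exists_eq_mk (s : D.GlobalSection) (x : NR M) :
    ∃ t : WithTop ℝ, s.toFun (T.proj x) = LineBundle.mk D x t := by
  obtain ⟨⟨x', t⟩, h⟩ := Quotient.exists_rep (s.toFun (T.proj x))
  have h1 := s.toBase_toFun (T.proj x)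
  rw [← h] at h1
  obtain ⟨u, rfl⟩ := T.proj_eq_iff.1 (show T.proj x' = T.proj x from h1)
  exact ⟨_, h.symm.trans (LineBundle.mk_add_incl D x' t u).symm⟩

/-- The pullback `π^* s : N_ℝ → 𝕋` of a global section `s`, that is, the unique function with
`s(π(x)) = [(x, (π^* s)(x))]`. -/
noncomputable def pullback (s : D.GlobalSection) (x : NR M) : WithTop ℝ :=
  Classical.choose (s.exists_eq_mk x)

theorem toFun_proj (s : D.GlobalSection) (x : NR M) :
    s.toFun (T.proj x) = LineBundle.mk D x (s.pullback x) :=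
  Classical.choose_spec (s.exists_eq_mk x)

variable [Module.Free ℤ M'] [Module.Finite ℤ M']

theorem pullback_add_incl (s : D.GlobalSection) (x : NR M) (u : M') :
    s.pullback (x + T.incl u) = s.pullback x + (D.factor u x : WithTop ℝ) := by
  apply LineBundle.mk_injective D (x + T.incl u)
  rw [← toFun_proj, LineBundle.mk_add_incl, ← toFun_proj]
  exact congrArg s.toFun (T.proj_eq_iff.2 ⟨u, rfl⟩).symm

/-- The map `X → 𝕋ℙ^N`, `y ↦ (s₀(y) : ⋯ : s_N(y))`, for global sections `s₀, …, s_N` that do not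
take the value `+∞`. The homogeneous coordinates of the image of `π(x)` are the values
`(π^* s_i)(x)`, i.e. one identifies the fibre of the line bundle over `π(x)` with `𝕋` by means
of `x`; another choice of `x` adds a common real constant to them. -/
noncomputable def toProjective {N : ℕ} (s : Fin (N + 1) → D.GlobalSection)
    (hs : ∀ i x, (s i).pullback x ≠ ⊤) (y : T.Space) : TropicalProjectiveSpace N :=
  Quotient.liftOn' y
    (fun x => TropicalProjectiveSpace.mk ⟨fun i => (s i).pullback x, 0, hs 0 x⟩) (by
      intro x x' h
      obtain ⟨u, rfl⟩ := T.proj_eq_iff.1 (Quotient.sound' h : T.proj x = T.proj x')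
      exact Quotient.sound (s := tropicalProjectiveSetoid N)
        ⟨D.factor u x, fun i => by simp only [pullback_add_incl, add_comm]⟩)

end GlobalSection

section Theta

variable [Module.Free ℤ M'] [Module.Finite ℤ M'] {D}

/-- The global section of `L(λ, γ)` given by the theta function `ϑ_b`, for `λ` a polarization. -/
noncomputable def thetaSection (hD : D.IsPolarization) (b : M) : D.GlobalSection where
  toFun y := Quotient.liftOn' y (fun x => LineBundle.mk D x (D.theta b x : WithTop ℝ)) (by
    intro x x' h
    obtain ⟨u, rfl⟩ := T.proj_eq_iff.1 (Quotient.sound' h : T.proj x = T.proj x')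
    rw [hD.theta_add_incl, WithTop.coe_add, LineBundle.mk_add_incl])
  toBase_toFun y := by
    obtain ⟨x, rfl⟩ := T.proj_surjective y
    rfl

theorem pullback_thetaSection (hD : D.IsPolarization) (b : M) (x : NR M) :
    (thetaSection hD b).pullback x = (D.theta b x : WithTop ℝ) :=
  (LineBundle.mk_injective D x ((thetaSection hD b).toFun_proj x)).symm

/-- The map `φ : X → 𝕋ℙ^N` defined by the sections of `L(λ, γ)` given by the theta functions
`ϑ_{b₀}, …, ϑ_{b_N}`. -/
noncomputable def thetaMap (hD : D.IsPolarization) {N : ℕ} (b : Fin (N + 1) → M) :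
    T.Space → TropicalProjectiveSpace N :=
  GlobalSection.toProjective (fun i => thetaSection hD (b i)) fun i x => by
    rw [pullback_thetaSection]
    exact WithTop.coe_ne_top

end Theta

/-- `b` is a complete system of representatives of `M / λ(M')`. -/
def IsCompleteSystem {ι : Type*} (b : ι → M) : Prop :=
  Function.Bijective fun i => (Submodule.Quotient.mk (b i) : M ⧸ LinearMap.range D.lam)

end TropicalDescentDatum
end Datum
end TropicalAbelian

/-! Completing the square turns theta functions into distance functions. Positivity makes `Q`
nondegenerate, so evaluation at `b ∈ M` is `Q(h b, ·)` for a vector `h b`, where `h (λ u) = u`;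
likewise the additive part of `γ` is `Q(c, ·)` on `M'`. Then `ϑ_b(x)` is half the squared distance
of `-(h b + x + c)` from `M'`, up to a function of `x` alone and a constant depending on `b` alone.
With `k = d₁` one has `λ = k δ` and `h (δ u) = u / k`, so `h M` contains all `k`-division points of
`M'`.

Injectivity, for `k ≥ 3`: equal images give `y`, `y'` such that `F a = distSq (y' + a) - distSq (y +
a)` has a constant value `κ` at the `k`-division points. Nearest lattice vectors for `y + a`, `y +
b`, `y - a - b` and `y`, with weights 1, 1, 1, `k - 3`, average to such a point. Hence
`distSq_sum_le`, used in both directions, gives `F a + F b + F (-a - b) + (k - 3) F 0 = k κ`. So `F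
- F 0` is additive; being bounded, it vanishes, and the values at `-y` and `-y'` show `y' - y ∈ M'`.
Compactness of `X` does the rest.

Unimodularity: at a generic point `x` each `ϑ_{b_i}` has a unique minimizer `u_i`, and it suffices
that the differences of the linear parts `b_i + λ(u_i)` generate `M`. Among these parts is every `δ
w` with `k (x + c) + w` in `k V`, where `V` is the Voronoi cell. So the claim reduces to
`eq_top_of_voronoi`: the differences of the points of `(z + M') ∩ k V` generate `M'`. For `k ≥ 3`
this follows from `V + 2V ⊆ 3V`, as the lattice vectors in `2V` generate; for `k = 2`, needed only
in ranks one and two, reduced bases are used. A hyperplane arrangement carries the conclusion from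
generic points to all cells (`isUnimodularOn_of_min`). -/

namespace TropicalAbelian

/-! ### Positive definite forms on lattices -/

section Lattice

variable {E L : Type*} [AddCommGroup E] [Module ℝ E] [AddCommGroup L]

/-- The `k`-th multiple of the (closed) Voronoi cell of the lattice `ι L` at the origin. -/
def voronoi (Q : E →ₗ[ℝ] E →ₗ[ℝ] ℝ) (ι : L →+ E) (k : ℝ) : Set E :=
  {z | ∀ w : L, 0 ≤ 2 * Q z (ι w) + k * Q (ι w) (ι w)}

variable {Q : E →ₗ[ℝ] E →ₗ[ℝ] ℝ} {ι : L →+ E}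

theorem form_self_nonneg (hpos : ∀ x, x ≠ 0 → 0 < Q x x) (x : E) : 0 ≤ Q x x := by
  by_cases h : x = 0
  · simp [h]
  · exact (hpos x h).le

theorem continuous_form_equivFun_symm {n : ℕ} (Q : E →ₗ[ℝ] E →ₗ[ℝ] ℝ)
    (bR : Module.Basis (Fin n) ℝ E) :
    Continuous fun v : Fin n → ℝ => Q (bR.equivFun.symm v) (bR.equivFun.symm v) := by
  have : (fun v : Fin n → ℝ => Q (bR.equivFun.symm v) (bR.equivFun.symm v)) =
      fun v => ∑ i, ∑ j, v j * (v i * Q (bR i) (bR j)) := by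
    ext v
    simp [Module.Basis.equivFun_symm_apply, Finset.mul_sum]
    exact Finset.sum_comm
  rw [this]
  fun_prop

/-- The constant is the minimum of the form on the compact unit sphere; homogeneity extends the
bound. -/
theorem exists_mul_sq_norm_le_form {n : ℕ} (bR : Module.Basis (Fin n) ℝ E)
    (hpos : ∀ x, x ≠ 0 → 0 < Q x x) :
    ∃ ε > 0, ∀ v : Fin n → ℝ, ε * ‖v‖ ^ 2 ≤ Q (bR.equivFun.symm v) (bR.equivFun.symm v) := by
  let q : (Fin n → ℝ) → ℝ := fun v => Q (bR.equivFun.symm v) (bR.equivFun.symm v)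
  have hq : Continuous q := continuous_form_equivFun_symm Q bR
  have hscale : ∀ (r : ℝ) v, q (r • v) = r ^ 2 * q v := fun r v => by
    simp only [q, map_smul, LinearMap.smul_apply, smul_eq_mul]
    ring
  obtain ⟨ε, hε, h⟩ : ∃ ε > 0, ∀ v ∈ Metric.sphere (0 : Fin n → ℝ) 1, ε ≤ q v := by
    rcases (Metric.sphere (0 : Fin n → ℝ) 1).eq_empty_or_nonempty with h0 | h0
    · exact ⟨1, one_pos, by simp [h0]⟩
    · obtain ⟨v, hv, hmin⟩ := (isCompact_sphere (0 : Fin n → ℝ) 1).exists_isMinOn h0 hq.continuousOn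
      refine ⟨q v, hpos _ fun h => ?_, fun w hw => hmin hw⟩
      have : v = 0 := bR.equivFun.symm.map_eq_zero_iff.1 h
      simp [this] at hv
  refine ⟨ε, hε, fun v => ?_⟩
  by_cases hv : v = 0
  · simp [hv]
  · have hn : ‖v‖ ≠ 0 := norm_ne_zero_iff.2 hv
    have h1 := h (‖v‖⁻¹ • v) (by simp [norm_smul, hn])
    have h2 := hscale ‖v‖ (‖v‖⁻¹ • v)
    rw [smul_inv_smul₀ hn] at h2
    change _ ≤ q v
    rw [h2, mul_comm]
    gcongr

theorem map_eq_equivFun_symm {n : ℕ} {e : Module.Basis (Fin n) ℤ L}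
    {bR : Module.Basis (Fin n) ℝ E} (he : ∀ i, bR i = ι (e i)) (u : L) :
    ι u = bR.equivFun.symm fun i => (e.equivFun u i : ℝ) := by
  conv_lhs => rw [← e.sum_equivFun u]
  simp only [map_sum, map_zsmul, Module.Basis.equivFun_symm_apply, he]
  exact Finset.sum_congr rfl fun i _ => (Int.cast_smul_eq_zsmul ℝ _ _).symm

theorem finite_form_le {n : ℕ} (e : Module.Basis (Fin n) ℤ L) (bR : Module.Basis (Fin n) ℝ E)
    (he : ∀ i, bR i = ι (e i)) (hpos : ∀ x, x ≠ 0 → 0 < Q x x) (R : ℝ) :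
    {u : L | Q (ι u) (ι u) ≤ R}.Finite := by
  obtain ⟨ε, hε, h⟩ := exists_mul_sq_norm_le_form bR hpos
  let C : ℤ := ⌈Real.sqrt (R / ε)⌉
  refine Set.Finite.subset ((Set.finite_Icc (fun _ : Fin n => -C) fun _ => C).preimage
    e.equivFun.injective.injOn) fun u hu => ?_
  have h1 := h fun i => (e.equivFun u i : ℝ)
  rw [← map_eq_equivFun_symm he] at h1
  have h2 : ‖fun i => (e.equivFun u i : ℝ)‖ ≤ C := by
    refine le_trans (Real.le_sqrt_of_sq_le ?_) (Int.le_ceil _)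
    rw [le_div_iff₀ hε, mul_comm]
    exact h1.trans hu
  have h3 : ∀ i, |e.equivFun u i| ≤ C := fun i => by
    have := (norm_le_pi_norm (fun i => (e.equivFun u i : ℝ)) i).trans h2
    rw [Real.norm_eq_abs] at this
    exact_mod_cast this
  exact ⟨fun i => (abs_le.1 (h3 i)).1, fun i => (abs_le.1 (h3 i)).2⟩

/-! ### Nearest lattice vectors and lattice points in multiples of the Voronoi cell -/

variable (hsymm : ∀ x y, Q x y = Q y x) (hpos : ∀ x, x ≠ 0 → 0 < Q x x)
  (hfin : ∀ R, {u : L | Q (ι u) (ι u) ≤ R}.Finite)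

include hsymm hpos in
-- The triangle inequality for `w = (z + w) - z`, obtained from `0 ≤ Q(2z + w, 2z + w)`. It confines
-- minimizers to a finite set.
theorem form_le_of_form_add_le (z w : E) (h : Q (z + w) (z + w) ≤ Q z z) : Q w w ≤ 4 * Q z z := by
  have h1 := form_self_nonneg hpos (z + z + w)
  have h2 := hsymm z w
  simp only [map_add, LinearMap.add_apply] at *
  linarith

include hsymm hpos hfin in
theorem exists_form_add_min (z : E) :
    ∃ u₀ : L, ∀ u : L, Q (z + ι u₀) (z + ι u₀) ≤ Q (z + ι u) (z + ι u) := by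
  have hF : {u : L | Q (z + ι u) (z + ι u) ≤ Q z z}.Finite :=
    (hfin (4 * Q z z)).subset fun u hu => form_le_of_form_add_le hsymm hpos z _ hu
  obtain ⟨u₀, h0, hmin⟩ := Set.exists_min_image _ (fun u : L => Q (z + ι u) (z + ι u)) hF
    ⟨0, by simp⟩
  refine ⟨u₀, fun u => ?_⟩
  by_cases h : Q (z + ι u) (z + ι u) ≤ Q z z
  · exact hmin u h
  · exact h0.trans (not_le.1 h).le

include hsymm in
theorem mem_voronoi_one {z : E} :
    z ∈ voronoi Q ι 1 ↔ ∀ w : L, Q z z ≤ Q (z + ι w) (z + ι w) := by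
  refine forall_congr' fun w => ?_
  have := hsymm z (ι w)
  simp only [map_add, LinearMap.add_apply]
  constructor <;> intro h <;> linarith

theorem smul_mem_voronoi {k r : ℝ} (hr : 0 ≤ r) {z : E} (hz : z ∈ voronoi Q ι k) :
    r • z ∈ voronoi Q ι (r * k) := fun w => by
  have := mul_nonneg hr (hz w)
  simp only [map_smul, LinearMap.smul_apply, smul_eq_mul]
  linarith

theorem add_mem_voronoi {k l : ℝ} {y z : E} (hy : y ∈ voronoi Q ι k) (hz : z ∈ voronoi Q ι l) :
    y + z ∈ voronoi Q ι (k + l) := fun w => by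
  have := hy w
  have := hz w
  simp only [map_add, LinearMap.add_apply]
  linarith

include hpos in
theorem voronoi_mono {k l : ℝ} (h : k ≤ l) : voronoi Q ι k ⊆ voronoi Q ι l := fun z hz w => by
  have := hz w
  have := mul_le_mul_of_nonneg_right h (form_self_nonneg hpos (ι w))
  linarith

include hsymm hpos hfin in
/-- The lattice vectors in twice the Voronoi cell generate the lattice. -/
theorem eq_top_of_voronoi_two {H : AddSubgroup L}
    (hH : ∀ v : L, ι v ∈ voronoi Q ι 2 → v ∈ H) : H = ⊤ := by
  by_contra hne
  obtain ⟨v₀, hv₀⟩ : ∃ v, v ∉ H := by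
    by_contra! h
    exact hne ((AddSubgroup.eq_top_iff' H).2 h)
  -- Take a shortest lattice vector `v` outside `H`. If some `w` violated the condition for `v` to
  -- lie in `2V`, then `v = (v + w) + (-w)` would be a sum of two strictly shorter vectors, both in
  -- `H`.
  obtain ⟨v, ⟨hvH, hv⟩, hmin⟩ := Set.exists_min_image
    {u : L | u ∉ H ∧ Q (ι u) (ι u) ≤ Q (ι v₀) (ι v₀)} (fun u : L => Q (ι u) (ι u))
    ((hfin _).subset fun u hu => hu.2) ⟨v₀, hv₀, le_rfl⟩
  have hlt : ∀ u : L, Q (ι u) (ι u) < Q (ι v) (ι v) → u ∈ H := fun u hu => by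
    by_contra hn
    exact (hmin u ⟨hn, hu.le.trans hv⟩).not_gt hu
  refine hvH (hH v fun w => ?_)
  by_contra! hw
  have h1 := hsymm (ι v) (ι w)
  have h2 := form_self_nonneg hpos (ι w)
  have h3 := form_self_nonneg hpos (ι v + ι w)
  have a1 : v + w ∈ H := hlt _ (by
    simp only [map_add, LinearMap.add_apply]
    linarith)
  have a2 : -w ∈ H := hlt _ (by
    simp only [map_add, LinearMap.add_apply, map_neg, LinearMap.neg_apply] at *
    linarith)
  exact hvH (by simpa using H.add_mem a1 a2)

include hsymm hpos hfin in
-- A nearest translate `z + u₀` lies in `V`, and adding a lattice vector `v` of `2V` keeps it in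
-- `3V`. So each generator `v` is a difference of two admissible vectors.
theorem eq_top_of_three_le {k : ℝ} (hk : 3 ≤ k) (z : E) {H : AddSubgroup L}
    (hH : ∀ u u' : L, z + ι u ∈ voronoi Q ι k → z + ι u' ∈ voronoi Q ι k → u - u' ∈ H) :
    H = ⊤ := by
  obtain ⟨u₀, hu₀⟩ := exists_form_add_min hsymm hpos hfin z
  have h1 : z + ι u₀ ∈ voronoi Q ι 1 := (mem_voronoi_one hsymm).2 fun w => by
    simpa [add_assoc] using hu₀ (u₀ + w)
  refine eq_top_of_voronoi_two hsymm hpos hfin fun v hv => ?_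
  have h2 : z + ι (u₀ + v) ∈ voronoi Q ι (1 + 2) := by
    simpa only [map_add, add_assoc] using add_mem_voronoi h1 hv
  have := hH (u₀ + v) u₀ (voronoi_mono hpos (by linarith) h2)
    (voronoi_mono hpos (by linarith) h1)
  simpa using this

/-- This integrality estimate places vectors with small coefficients in `2V`. -/
theorem mul_intCast_le_sq {s : ℝ} (hs : |s| ≤ 1) (i : ℤ) : s * i ≤ (i : ℝ) ^ 2 := by
  have h1 : |(i : ℝ)| ≤ (i : ℝ) ^ 2 := by
    have : |i| ≤ i ^ 2 := by
      rw [← sq_abs]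
      rcases (abs_nonneg i).eq_or_lt with h | h
      · simp [← h]
      · nlinarith
    exact_mod_cast this
  calc s * i ≤ |s * i| := le_abs_self _
    _ = |s| * |(i : ℝ)| := abs_mul _ _
    _ ≤ 1 * |(i : ℝ)| := by gcongr
    _ ≤ _ := by linarith

include hpos in
-- `2V` contains the segment from `-a` to `a`. It therefore contains two translates of `z` that
-- differ by `a`, with coefficients the fractional part of `s` and that minus one.
theorem eq_top_of_rank_one {k : ℝ} (hk : 2 ≤ k) {a : L} (ha : AddSubgroup.closure {a} = ⊤)
    (z : E) (hz : ∃ s : ℝ, z = s • ι a) {H : AddSubgroup L}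
    (hH : ∀ u u' : L, z + ι u ∈ voronoi Q ι k → z + ι u' ∈ voronoi Q ι k → u - u' ∈ H) :
    H = ⊤ := by
  obtain ⟨s, rfl⟩ := hz
  have hmem : ∀ t : ℝ, |t| ≤ 1 → t • ι a ∈ voronoi Q ι k := fun t ht =>
    voronoi_mono hpos hk fun w => by
      obtain ⟨i, rfl⟩ := AddSubgroup.mem_closure_singleton.1 (ha ▸ AddSubgroup.mem_top w)
      have h1 := mul_intCast_le_sq (s := -t) (by rwa [abs_neg]) i
      have h2 := mul_le_mul_of_nonneg_right h1 (form_self_nonneg hpos (ι a))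
      simp only [map_zsmul, map_smul, LinearMap.smul_apply, smul_eq_mul, zsmul_eq_mul] at *
      linarith
  have e : ∀ j : ℤ, s • ι a + ι (j • a) = (s + j) • ι a := fun j => by
    rw [map_zsmul, add_smul, Int.cast_smul_eq_zsmul]
  have f1 := Int.fract_nonneg s
  have f2 := (Int.fract_lt_one s).le
  rw [Int.fract] at f1 f2
  have := hH ((-⌊s⌋) • a) ((-⌊s⌋ - 1) • a)
    (by rw [e]; apply hmem; rw [abs_le]; push_cast; constructor <;> linarith)
    (by rw [e]; apply hmem; rw [abs_le]; push_cast; constructor <;> linarith)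
  rw [← sub_smul, sub_sub_cancel, one_smul] at this
  rw [← top_le_iff, ← ha]
  simpa using this

include hsymm hfin in
/-- Existence of a reduced basis of a lattice of rank two. -/
theorem exists_reduced_generators (hpos : ∀ x, x ≠ 0 → 0 < Q x x)
    {a₀ b₀ : L} (h₀ : AddSubgroup.closure {a₀, b₀} = ⊤) :
    ∃ a b : L, AddSubgroup.closure {a, b} = ⊤ ∧ 0 ≤ Q (ι a) (ι b) ∧
      Q (ι a) (ι b) ≤ Q (ι a) (ι a) ∧ Q (ι a) (ι b) ≤ Q (ι b) (ι b) := by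
  -- The sum of the norms of the superbase `a, -b, b - a`. At a minimum, comparison with the pairs
  -- `(a, -b)`, `(a, b - a)` and `(a - b, b)` yields the three inequalities.
  let f : L × L → ℝ := fun p => Q (ι p.1) (ι p.1) + Q (ι p.2) (ι p.2)
    + Q (ι p.1 - ι p.2) (ι p.1 - ι p.2)
  have nn := fun u : L => form_self_nonneg hpos (ι u)
  have hF : {p : L × L | AddSubgroup.closure {p.1, p.2} = ⊤ ∧ f p ≤ f (a₀, b₀)}.Finite := by
    refine ((hfin (f (a₀, b₀))).prod (hfin (f (a₀, b₀)))).subset ?_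
    rintro p ⟨-, hp⟩
    have h1 := nn p.1
    have h2 := nn p.2
    have h3 := form_self_nonneg hpos (ι p.1 - ι p.2)
    constructor <;> refine le_trans ?_ hp <;> simp only [f] <;> linarith
  obtain ⟨⟨a, b⟩, ⟨hab, hle⟩, hmin⟩ := Set.exists_min_image _ f hF ⟨(a₀, b₀), h₀, le_rfl⟩
  have key : ∀ a' b' : L, a ∈ AddSubgroup.closure {a', b'} → b ∈ AddSubgroup.closure {a', b'} →
      f (a, b) ≤ f (a', b') := fun a' b' ha hb => by
    by_contra! hlt
    refine (hmin (a', b') ⟨?_, (hlt.trans_le hle).le⟩).not_gt hlt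
    rw [← top_le_iff, ← hab, AddSubgroup.closure_le]
    rintro x (rfl | rfl) <;> assumption
  have g1 : ∀ a' b' : L, a' ∈ AddSubgroup.closure {a', b'} := fun a' b' =>
    AddSubgroup.subset_closure (by simp)
  have g2 : ∀ a' b' : L, b' ∈ AddSubgroup.closure {a', b'} := fun a' b' =>
    AddSubgroup.subset_closure (by simp)
  have s1 := hsymm (ι a) (ι b)
  refine ⟨a, b, hab, ?_, ?_, ?_⟩
  · have := key a (-b) (g1 _ _) (by simpa using neg_mem (g2 a (-b)))
    simp only [f, map_neg, map_sub, LinearMap.sub_apply, LinearMap.neg_apply] at this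
    linarith
  · have := key a (b - a) (g1 _ _) (by simpa using add_mem (g2 a (b - a)) (g1 a (b - a)))
    simp only [f, map_sub, LinearMap.sub_apply] at this
    linarith
  · have := key (a - b) b (by simpa using add_mem (g1 (a - b) b) (g2 (a - b) b)) (g2 _ _)
    simp only [f, map_sub, LinearMap.sub_apply] at this
    linarith

include hsymm hpos hfin in
-- In a reduced basis `2V` contains the hexagon `|s|, |t|, |s + t| ≤ 1`. Three of the four
-- translates of `z` with coefficients in `[-1, 1]` obtained from fractional parts lie in it, and
-- their differences generate.
theorem eq_top_of_rank_two {k : ℝ} (hk : 2 ≤ k) {a₀ b₀ : L}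
    (h₀ : AddSubgroup.closure {a₀, b₀} = ⊤) (z : E) (hz : z ∈ Submodule.span ℝ (range ι))
    {H : AddSubgroup L}
    (hH : ∀ u u' : L, z + ι u ∈ voronoi Q ι k → z + ι u' ∈ voronoi Q ι k → u - u' ∈ H) :
    H = ⊤ := by
  obtain ⟨a, b, hab, c0, c1, c2⟩ := exists_reduced_generators hsymm hfin hpos h₀
  have hw : ∀ w : L, ∃ i j : ℤ, i • a + j • b = w := fun w =>
    AddSubgroup.mem_closure_pair.1 (hab ▸ AddSubgroup.mem_top w)
  have s1 := hsymm (ι a) (ι b)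
  -- Selling's formula writes the norm of `i a + j b` as a combination of `i²`, `j²`, `(i + j)²`
  -- with coefficients `Q(a,a) - Q(a,b)`, `Q(b,b) - Q(a,b)`, `Q(a,b)`, nonnegative for a reduced
  -- basis. The pairing with `s a + t b` splits in the same way.
  have hmem : ∀ s t : ℝ, |s| ≤ 1 → |t| ≤ 1 → |s + t| ≤ 1 →
      s • ι a + t • ι b ∈ voronoi Q ι k := fun s t hs ht hst =>
    voronoi_mono hpos hk fun w => by
      obtain ⟨i, j, rfl⟩ := hw w
      have h1 := mul_le_mul_of_nonneg_right
        (mul_intCast_le_sq (s := -s) (by rwa [abs_neg]) i) (sub_nonneg.2 c1)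
      have h2 := mul_le_mul_of_nonneg_right
        (mul_intCast_le_sq (s := -t) (by rwa [abs_neg]) j) (sub_nonneg.2 c2)
      have h3 := mul_le_mul_of_nonneg_right
        (mul_intCast_le_sq (s := -(s + t)) (by rwa [abs_neg]) (i + j)) c0
      push_cast at h3
      simp only [map_add, LinearMap.add_apply, map_zsmul, map_smul, LinearMap.smul_apply,
        smul_eq_mul, zsmul_eq_mul]
      rw [← s1]
      linarith
  obtain ⟨s, t, rfl⟩ : ∃ s t : ℝ, s • ι a + t • ι b = z := by
    rw [← Submodule.mem_span_pair]
    refine Submodule.span_le.2 ?_ hz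
    rintro _ ⟨w, rfl⟩
    obtain ⟨i, j, rfl⟩ := hw w
    exact Submodule.mem_span_pair.2 ⟨i, j, by simp [Int.cast_smul_eq_zsmul]⟩
  have e : ∀ i j : ℤ, s • ι a + t • ι b + ι (i • a + j • b) = (s + i) • ι a + (t + j) • ι b :=
    fun i j => by
      rw [map_add, map_zsmul, map_zsmul, add_smul, add_smul, Int.cast_smul_eq_zsmul,
        Int.cast_smul_eq_zsmul]
      abel
  have hmem' : ∀ i j : ℤ, |s + i| ≤ 1 → |t + j| ≤ 1 → |s + i + (t + j)| ≤ 1 →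
      s • ι a + t • ι b + ι (i • a + j • b) ∈ voronoi Q ι k := fun i j h1 h2 h3 => by
    rw [e]
    exact hmem _ _ h1 h2 h3
  have f1 := Int.fract_nonneg s
  have f2 := (Int.fract_lt_one s).le
  have f3 := Int.fract_nonneg t
  have f4 := (Int.fract_lt_one t).le
  rw [Int.fract] at f1 f2 f3 f4
  have hgen : a ∈ H ∧ b ∈ H := by
    have i1 := hmem' (-⌊s⌋ - 1) (-⌊t⌋)
    have i2 := hmem' (-⌊s⌋) (-⌊t⌋ - 1)
    simp only [abs_le] at i1 i2
    push_cast at i1 i2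
    have j1 := i1 ⟨by linarith, by linarith⟩ ⟨by linarith, by linarith⟩
      ⟨by linarith, by linarith⟩
    have j2 := i2 ⟨by linarith, by linarith⟩ ⟨by linarith, by linarith⟩
      ⟨by linarith, by linarith⟩
    -- The diagonal of the unit square decides which of the corners `(0, 0)` and `(-1, -1)` supplies
    -- the third point.
    rcases le_total (s - ⌊s⌋ + (t - ⌊t⌋)) 1 with h | h
    · have i0 := hmem' (-⌊s⌋) (-⌊t⌋)
      simp only [abs_le] at i0
      push_cast at i0
      have j0 := i0 ⟨by linarith, by linarith⟩ ⟨by linarith, by linarith⟩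
        ⟨by linarith, by linarith⟩
      have k1 := hH _ _ j0 j1
      have k2 := hH _ _ j0 j2
      exact ⟨by convert k1 using 1; module, by convert k2 using 1; module⟩
    · have i0 := hmem' (-⌊s⌋ - 1) (-⌊t⌋ - 1)
      simp only [abs_le] at i0
      push_cast at i0
      have j0 := i0 ⟨by linarith, by linarith⟩ ⟨by linarith, by linarith⟩
        ⟨by linarith, by linarith⟩
      have k1 := hH _ _ j1 j0
      have k2 := hH _ _ j2 j0
      exact ⟨by convert k2 using 1; module, by convert k1 using 1; module⟩
  rw [← top_le_iff, ← hab, AddSubgroup.closure_le]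
  rintro x (rfl | rfl)
  exacts [hgen.1, hgen.2]

end Lattice

end TropicalAbelian

namespace TropicalAbelian

/-! ### Unimodular matrices -/

/-- Expressing the unit vectors through the rows gives an integral left inverse `c` of `A`. So `A`
is injective, and `r y = A x` implies `x = r (c y)`, hence `y = A (c y)`. -/
theorem isUnimodularMatrix_of_span_eq_top {m k : ℕ} {A : Matrix (Fin k) (Fin m) ℤ}
    (hA : Submodule.span ℤ (range A) = ⊤) : IsUnimodularMatrix A := by
  have h : ∀ j : Fin m, ∃ c : Fin k → ℤ, ∑ i, c i • A i = Pi.single j 1 := fun j =>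
    (Submodule.mem_span_range_iff_exists_fun ℤ).1 (hA ▸ Submodule.mem_top)
  choose c hc using h
  have hinv : (Matrix.of c) * A = 1 := by
    ext j l
    have := congrFun (hc j) l
    simpa [Matrix.mul_apply, Matrix.one_apply, Pi.single_apply, eq_comm] using this
  have hleft : ∀ x, (Matrix.of c).mulVec (A.mulVec x) = x := fun x => by
    rw [Matrix.mulVec_mulVec, hinv, Matrix.one_mulVec]
  constructor
  · rw [Matrix.rank, LinearMap.finrank_range_of_inj
      (Function.LeftInverse.injective (f := A.mulVecLin) (g := (Matrix.of c).mulVec) hleft)]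
    simp
  · refine .of_smul_eq_zero fun r y h => ?_
    obtain ⟨y, rfl⟩ := Submodule.Quotient.mk_surjective _ y
    rw [or_iff_not_imp_left]
    intro hr
    rw [← Submodule.Quotient.mk_smul, Submodule.Quotient.mk_eq_zero] at h
    obtain ⟨x, hx⟩ := h
    rw [Submodule.Quotient.mk_eq_zero]
    refine ⟨(Matrix.of c).mulVec y, smul_right_injective _ hr ?_⟩
    have h1 : x = r • (Matrix.of c).mulVec y := by
      rw [← hleft x, ← Matrix.mulVec_smul]
      exact congrArg _ hx
    change r • A.mulVecLin _ = r • y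
    rw [← hx, h1, map_smul]

/-! ### Hyperplane arrangements -/

section Arrangement

variable {m : ℕ}

def slack (p : (Fin m → ℤ) × ℝ) (x : Fin m → ℝ) : ℝ := ∑ i, (p.1 i : ℝ) * x i - p.2

theorem mem_polyhedron {S : Finset ((Fin m → ℤ) × ℝ)} {x : Fin m → ℝ} :
    x ∈ polyhedron S ↔ ∀ p ∈ S, 0 ≤ slack p x := by
  simp [polyhedron, slack]

theorem slack_neg (p : (Fin m → ℤ) × ℝ) (x : Fin m → ℝ) : slack (-p) x = -slack p x := by
  simp [slack]
  ring

theorem slack_combo (p : (Fin m → ℤ) × ℝ) (x y : Fin m → ℝ) (s t : ℝ) (h : s + t = 1) :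
    slack p (s • x + t • y) = s * slack p x + t * slack p y := by
  obtain rfl := eq_sub_of_add_eq h
  simp only [slack, Pi.add_apply, Pi.smul_apply, smul_eq_mul, mul_add, Finset.sum_add_distrib,
    mul_sub, Finset.mul_sum, mul_left_comm]
  ring

theorem continuous_slack (p : (Fin m → ℤ) × ℝ) : Continuous (slack p) := by
  unfold slack
  fun_prop

theorem convex_polyhedron (S : Finset ((Fin m → ℤ) × ℝ)) : Convex ℝ (polyhedron S) := by
  intro x hx y hy s t hs ht hst
  rw [mem_polyhedron] at *
  intro p hp
  rw [slack_combo _ _ _ _ _ hst]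
  exact add_nonneg (mul_nonneg hs (hx p hp)) (mul_nonneg ht (hy p hp))

/-- Midpoints preserve positivity of slacks that are nonnegative on `K`. The resulting point serves
as a relative interior point. -/
theorem exists_forall_slack_pos {K : Set (Fin m → ℝ)} (hK : Convex ℝ K) (hne : K.Nonempty)
    (S : Finset ((Fin m → ℤ) × ℝ)) (h0 : ∀ p ∈ S, ∀ x ∈ K, 0 ≤ slack p x)
    (hS : ∀ p ∈ S, ∃ x ∈ K, 0 < slack p x) : ∃ x ∈ K, ∀ p ∈ S, 0 < slack p x := by
  induction S using Finset.induction_on with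
  | empty =>
    obtain ⟨x, hx⟩ := hne
    exact ⟨x, hx, by simp⟩
  | insert q S _ ih =>
    simp only [Finset.forall_mem_insert] at h0 hS ⊢
    obtain ⟨x, hx, hxS⟩ := ih h0.2 hS.2
    obtain ⟨y, hy, hyq⟩ := hS.1
    have hst : (1 / 2 : ℝ) + 1 / 2 = 1 := by norm_num
    refine ⟨(1 / 2 : ℝ) • x + (1 / 2 : ℝ) • y,
      hK hx hy (by norm_num) (by norm_num) hst, ?_, fun p hp => ?_⟩
    · rw [slack_combo _ _ _ _ _ hst]
      linarith [h0.1 x hx]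
    · rw [slack_combo _ _ _ _ _ hst]
      linarith [hxS p hp, h0.2 p hp y hy]

/-- A nonempty face of a polyhedron can be described by means of any presentation. -/
theorem IsFace.exists_subset {τ : Set (Fin m → ℝ)} {S : Finset ((Fin m → ℤ) × ℝ)}
    (h : IsFace τ (polyhedron S)) (hne : τ.Nonempty) :
    ∃ T ⊆ S, τ = {x | x ∈ polyhedron S ∧ ∀ p ∈ T, slack p x = 0} := by
  classical
  obtain ⟨R, T, hTR, hSR, rfl⟩ := h
  simp only [← hSR, ← sub_eq_zero (b := Prod.snd _)] at hne ⊢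
  change Set.Nonempty {x | x ∈ polyhedron S ∧ ∀ p ∈ T, slack p x = 0} at hne
  change ∃ T' ⊆ S, {x | x ∈ polyhedron S ∧ ∀ p ∈ T, slack p x = 0} = _
  set τ := {x | x ∈ polyhedron S ∧ ∀ p ∈ T, slack p x = 0} with hτ
  have hconv : Convex ℝ τ := by
    rintro x ⟨hx, hx'⟩ y ⟨hy, hy'⟩ s t hs ht hst
    refine ⟨convex_polyhedron S hx hy hs ht hst, fun p hp => ?_⟩
    rw [slack_combo _ _ _ _ _ hst, hx' p hp, hy' p hp]
    simp
  -- `T` belongs to another presentation of the polyhedron; its replacement consists of all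
  -- inequalities of `S` that are equalities on `τ`.
  refine ⟨S.filter fun p => ∀ x ∈ τ, slack p x = 0, Finset.filter_subset _ _,
    subset_antisymm (fun x hx => ⟨hx.1, fun p hp => (Finset.mem_filter.1 hp).2 x hx⟩) ?_⟩
  rintro x ⟨hxS, hx⟩
  obtain ⟨z, hz, hzpos⟩ := exists_forall_slack_pos hconv hne
    (S.filter fun p => ∃ x ∈ τ, 0 < slack p x)
    (fun p hp y hy => mem_polyhedron.1 hy.1 p (Finset.mem_filter.1 hp).1)
    (fun p hp => (Finset.mem_filter.1 hp).2)
  -- The segment from `x` to the relatively interior point `z` can be prolonged slightly beyond `z`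
  -- inside the polyhedron. An inequality of `T` that is tight at `z` and valid at both ends must be
  -- tight at `x`.
  have hcont : Continuous fun ε : ℝ => (1 + ε) • z + (-ε) • x := by fun_prop
  have hev : ∀ᶠ ε : ℝ in 𝓝[>] 0, ∀ p ∈ S.filter fun p => ∃ x ∈ τ, 0 < slack p x,
      0 < slack p ((1 + ε) • z + (-ε) • x) := by
    refine (Finset.eventually_all _).2 fun p hp => nhdsWithin_le_nhds ?_
    refine ((continuous_slack p).comp hcont).continuousAt.eventually_const_lt ?_
    simpa using hzpos p hp
  obtain ⟨ε, hε, hε0⟩ := (hev.and self_mem_nhdsWithin).exists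
  replace hε0 : 0 < ε := hε0
  have hw : (1 + ε) • z + (-ε) • x ∈ polyhedron S := mem_polyhedron.2 fun p hp => by
    by_cases h : ∃ x ∈ τ, 0 < slack p x
    · exact (hε p (Finset.mem_filter.2 ⟨hp, h⟩)).le
    · push Not at h
      have h0 : ∀ y ∈ τ, slack p y = 0 := fun y hy =>
        le_antisymm (h y hy) (mem_polyhedron.1 hy.1 p hp)
      rw [slack_combo _ _ _ _ _ (by ring), h0 z hz, hx p (Finset.mem_filter.2 ⟨hp, h0⟩)]
      simp
  refine ⟨hxS, fun p hp => le_antisymm ?_ (mem_polyhedron.1 (hSR ▸ hxS) p (hTR hp))⟩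
  have h1 := mem_polyhedron.1 (hSR ▸ hw) p (hTR hp)
  rw [slack_combo _ _ _ _ _ (by ring), hz.2 p hp] at h1
  by_contra! h2
  nlinarith

/-- The cells of the arrangement of the hyperplanes `⟨v, x⟩ = c` for `(v, c) ∈ K`, where `K = -K`,
together with the empty set. -/
def arrangement (K : Finset ((Fin m → ℤ) × ℝ)) : Set (Set (Fin m → ℝ)) :=
  {σ | σ = ∅ ∨ ∃ S ⊆ K, (∀ p ∈ K, p ∈ S ∨ -p ∈ S) ∧ σ = polyhedron S}

theorem sUnion_arrangement (K : Finset ((Fin m → ℤ) × ℝ)) (hK : ∀ p ∈ K, -p ∈ K) :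
    ⋃₀ arrangement K = univ := by
  classical
  refine eq_univ_of_forall fun x => ⟨polyhedron (K.filter fun p => 0 ≤ slack p x),
    Or.inr ⟨_, Finset.filter_subset _ _, fun p hp => ?_, rfl⟩,
    mem_polyhedron.2 fun p hp => (Finset.mem_filter.1 hp).2⟩
  simp only [Finset.mem_filter, slack_neg]
  rcases le_total 0 (slack p x) with h | h
  · exact Or.inl ⟨hp, h⟩
  · exact Or.inr ⟨hK p hp, by linarith⟩

theorem isRationalPolyhedralComplex_arrangement (K : Finset ((Fin m → ℤ) × ℝ))
    (hK : ∀ p ∈ K, -p ∈ K) : IsRationalPolyhedralComplex (arrangement K) where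
  isRationalPolyhedron := by
    rintro σ (rfl | ⟨S, -, -, rfl⟩)
    exacts [⟨{(0, 1)}, by ext x; simp [polyhedron]⟩, ⟨S, rfl⟩]
  locallyFinite := by
    have : Finite (arrangement K) := by
      refine Set.Finite.subset
        ((Set.finite_singleton ∅).union (K.powerset.finite_toSet.image polyhedron)) ?_
      rintro σ (rfl | ⟨S, hS, -, rfl⟩)
      exacts [Or.inl rfl, Or.inr ⟨S, by simpa using hS, rfl⟩]
    exact locallyFinite_of_finite _
  face_mem := by
    classical
    intro σ hσ τ hτ
    rcases τ.eq_empty_or_nonempty with h | hne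
    · exact Or.inl h
    rcases hσ with rfl | ⟨S, hSK, hS, rfl⟩
    · obtain ⟨R, T, -, h1, rfl⟩ := hτ
      obtain ⟨x, hx⟩ := hne
      exact absurd (h1 ▸ hx.1) (notMem_empty x)
    · obtain ⟨T, hTS, rfl⟩ := hτ.exists_subset hne
      -- Adjoining `-p` to `p` forces equality, so a face is again a cell.
      refine Or.inr ⟨S ∪ T.image (- ·), ?_, fun p hp => ?_, ?_⟩
      · refine Finset.union_subset hSK fun p hp => ?_
        obtain ⟨q, hq, rfl⟩ := Finset.mem_image.1 hp
        exact hK q (hSK (hTS hq))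
      · exact (hS p hp).imp (Finset.mem_union_left _) (Finset.mem_union_left _)
      · ext x
        simp only [mem_ofPred_eq, mem_polyhedron, Finset.mem_union, Finset.mem_image]
        constructor
        · rintro ⟨h1, h2⟩ p (hp | ⟨q, hq, rfl⟩)
          · exact h1 p hp
          · rw [slack_neg, h2 q hq, neg_zero]
        · refine fun h => ⟨fun p hp => h p (Or.inl hp), fun p hp => ?_⟩
          have h1 := h p (Or.inl (hTS hp))
          have h2 := h (-p) (Or.inr ⟨p, hp, rfl⟩)
          rw [slack_neg] at h2
          linarith
  inter_isFace := by
    classical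
    have key : ∀ S ⊆ K, (∀ p ∈ K, p ∈ S ∨ -p ∈ S) → ∀ S' ⊆ K, (∀ p ∈ K, p ∈ S' ∨ -p ∈ S') →
        IsFace (polyhedron S ∩ polyhedron S') (polyhedron S) := by
      intro S hSK hS S' hSK' hS'
      refine ⟨S, S.filter fun p => -p ∈ S', Finset.filter_subset _ _, rfl, ?_⟩
      simp only [← sub_eq_zero (b := Prod.snd _)]
      change _ = {x | x ∈ polyhedron S ∧ ∀ p ∈ S.filter fun p => -p ∈ S', slack p x = 0}
      ext x
      simp only [mem_inter_iff, mem_ofPred_eq, mem_polyhedron, Finset.mem_filter]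
      refine and_congr_right fun h1 => ⟨fun h2 p hp => ?_, fun h2 p hp => ?_⟩
      · have h3 := h1 p hp.1
        have h4 := h2 _ hp.2
        rw [slack_neg] at h4
        linarith
      · rcases hS p (hSK' hp) with h | h
        · exact h1 p h
        · have h3 := h2 (-p) ⟨h, by rwa [neg_neg]⟩
          rw [slack_neg] at h3
          linarith
    rintro σ (rfl | ⟨S, hSK, hS, rfl⟩) σ' (rfl | ⟨S', hSK', hS', rfl⟩) hne
    · simp at hne
    · simp at hne
    · simp at hne
    · exact ⟨key S hSK hS S' hSK' hS', by
        rw [inter_comm]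
        exact key S' hSK' hS' S hSK hS⟩

/-- A point on a hyperplane leaves it when moved slightly along the normal vector, so the open set
can be shrunk to avoid the hyperplanes one at a time. -/
theorem exists_mem_slack_ne_zero {O : Set (Fin m → ℝ)} (hO : IsOpen O) (hne : O.Nonempty)
    (K : Finset ((Fin m → ℤ) × ℝ)) : ∃ x ∈ O, ∀ p ∈ K, p.1 ≠ 0 → slack p x ≠ 0 := by
  induction K using Finset.induction_on generalizing O with
  | empty =>
    obtain ⟨x, hx⟩ := hne
    exact ⟨x, hx, by simp⟩
  | insert q K _ ih =>
    by_cases hq : q.1 = 0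
    · obtain ⟨x, hx, h⟩ := ih hO hne
      exact ⟨x, hx, fun p hp hp0 => h p
        ((Finset.mem_insert.1 hp).resolve_left (by rintro rfl; exact hp0 hq)) hp0⟩
    · have hO' : IsOpen (O ∩ {x | slack q x ≠ 0}) :=
        hO.inter (isOpen_ne_fun (continuous_slack q) continuous_const)
      obtain ⟨x, hx, h⟩ := ih hO' (by
        obtain ⟨x, hx⟩ := hne
        by_cases h0 : slack q x = 0
        · let v : Fin m → ℝ := fun i => q.1 i
          have hcont : Continuous fun ε : ℝ => x + ε • v := by fun_prop
          have hev : ∀ᶠ ε : ℝ in 𝓝[>] 0, x + ε • v ∈ O := by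
            refine nhdsWithin_le_nhds (hcont.continuousAt.eventually_mem (hO.mem_nhds ?_))
            simpa using hx
          obtain ⟨ε, hε, hε0⟩ := (hev.and self_mem_nhdsWithin).exists
          replace hε0 : 0 < ε := hε0
          refine ⟨_, hε, ?_⟩
          have h1 : slack q (x + ε • v) = slack q x + ε * ∑ i, (q.1 i : ℝ) ^ 2 := by
            simp only [slack, v, Pi.add_apply, Pi.smul_apply, smul_eq_mul, mul_add,
              Finset.sum_add_distrib, Finset.mul_sum]
            have : ∀ i, (q.1 i : ℝ) * (ε * q.1 i) = ε * (q.1 i : ℝ) ^ 2 := fun i => by ring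
            simp only [this]
            ring
          obtain ⟨i, hi⟩ := Function.ne_iff.1 hq
          have h2 : 0 < ∑ i, (q.1 i : ℝ) ^ 2 := Finset.sum_pos' (fun i _ => sq_nonneg _)
            ⟨i, Finset.mem_univ i, by
              have : (q.1 i : ℝ) ≠ 0 := by exact_mod_cast hi
              positivity⟩
          rw [mem_ofPred_eq, h1, h0, zero_add]
          positivity
        · exact ⟨x, hx, h0⟩)
      refine ⟨x, hx.1, fun p hp hp0 => ?_⟩
      rcases Finset.mem_insert.1 hp with rfl | hp
      exacts [hx.2, h p hp hp0]

/-- The integral affine function `x ↦ ⟨v, x⟩ + c` given by the pair `(v, c)`. -/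
def affineValue (p : (Fin m → ℤ) × ℝ) (x : Fin m → ℝ) : ℝ := ∑ i, (p.1 i : ℝ) * x i + p.2

theorem slack_sub (p q : (Fin m → ℤ) × ℝ) (x : Fin m → ℝ) :
    slack (q.1 - p.1, p.2 - q.2) x = affineValue q x - affineValue p x := by
  simp [slack, affineValue, sub_mul]
  ring

/-- A map whose components are differences of minima of finitely many integral affine functions is
unimodular if it is so at the generic points. -/
theorem isUnimodularOn_of_min {k : ℕ} {U : Set (Fin m → ℝ)} (hU : IsOpen U)
    (hconv : Convex ℝ U) (hne : U.Nonempty) (A : Fin (k + 1) → Finset ((Fin m → ℤ) × ℝ))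
    (hA : ∀ i, ∀ p ∈ A i, ∀ q ∈ A i, p.1 = q.1 → p = q)
    (g : Fin (k + 1) → (Fin m → ℝ) → ℝ)
    (hg : ∀ i, ∀ x ∈ U, ∃ p ∈ A i, g i x = affineValue p x)
    (hg' : ∀ i, ∀ x ∈ U, ∀ p ∈ A i, g i x ≤ affineValue p x)
    (hmin : ∀ x ∈ U, ∀ p : Fin (k + 1) → (Fin m → ℤ) × ℝ, (∀ i, p i ∈ A i) →
      (∀ i, ∀ q ∈ A i, q ≠ p i → affineValue (p i) x < affineValue q x) →
      IsUnimodularMatrix (Matrix.of fun i : Fin k => (p i.succ).1 - (p 0).1)) :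
    IsUnimodularOn (fun (x : U) (i : Fin k) => g i.succ x - g 0 x) := by
  classical
  -- The walls: the loci where two affine functions competing in the same minimum agree.
  let K : Finset ((Fin m → ℤ) × ℝ) := Finset.univ.biUnion fun i =>
    (A i ×ˢ A i).image fun r => (r.2.1 - r.1.1, r.1.2 - r.2.2)
  have hmemK : ∀ i, ∀ p ∈ A i, ∀ q ∈ A i, (q.1 - p.1, p.2 - q.2) ∈ K := fun i p hp q hq =>
    Finset.mem_biUnion.2 ⟨i, Finset.mem_univ i, Finset.mem_image.2
      ⟨(p, q), Finset.mem_product.2 ⟨hp, hq⟩, rfl⟩⟩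
  have hK : ∀ p ∈ K, -p ∈ K := by
    intro r hr
    obtain ⟨i, -, hr⟩ := Finset.mem_biUnion.1 hr
    obtain ⟨⟨p, q⟩, hpq, rfl⟩ := Finset.mem_image.1 hr
    obtain ⟨hp, hq⟩ := Finset.mem_product.1 hpq
    have := hmemK i q hq p hp
    simpa using this
  refine ⟨arrangement K, isRationalPolyhedralComplex_arrangement K hK,
    ⟨U, hU, by rw [sUnion_arrangement K hK, inter_univ]⟩, fun σ hσ => ?_⟩
  -- A cell may lie inside walls, so genericity is sought nearby: `O` surrounds a relatively
  -- interior point of `σ ∩ U`, and strict signs on `O` persist weakly on `σ ∩ U`. Minimizers at a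
  -- generic point of `O` thus remain minimizers on the cell.
  obtain ⟨O, hO, hOU, hOne, hOσ⟩ : ∃ O : Set (Fin m → ℝ), IsOpen O ∧ O ⊆ U ∧ O.Nonempty ∧
      ∀ y ∈ σ ∩ U, ∀ x ∈ O, ∀ p ∈ K, 0 < slack p x → 0 ≤ slack p y := by
    rcases (σ ∩ U).eq_empty_or_nonempty with h0 | h0
    · exact ⟨U, hU, subset_rfl, hne, by simp [h0]⟩
    rcases hσ with rfl | ⟨S, hSK, hS, rfl⟩
    · simp at h0
    obtain ⟨z, hz, hzpos⟩ := exists_forall_slack_pos ((convex_polyhedron S).inter hconv) h0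
      (S.filter fun p => ∃ x ∈ polyhedron S ∩ U, 0 < slack p x)
      (fun p hp y hy => mem_polyhedron.1 hy.1 p (Finset.mem_filter.1 hp).1)
      (fun p hp => (Finset.mem_filter.1 hp).2)
    refine ⟨U ∩ ⋂ p ∈ S.filter fun p => ∃ x ∈ polyhedron S ∩ U, 0 < slack p x,
      {x | 0 < slack p x}, hU.inter (isOpen_biInter_finset fun p _ =>
        isOpen_lt continuous_const (continuous_slack p)), inter_subset_left,
      ⟨z, hz.2, mem_iInter₂.2 hzpos⟩, fun y hy x hx p hp hpx => ?_⟩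
    rcases hS p hp with h | h
    · exact mem_polyhedron.1 hy.1 p h
    · by_contra! hlt
      have h1 : 0 < slack (-p) x := mem_iInter₂.1 hx.2 (-p)
        (Finset.mem_filter.2 ⟨h, y, hy, by rw [slack_neg]; linarith⟩)
      rw [slack_neg] at h1
      linarith
  obtain ⟨x, hx, hgen⟩ := exists_mem_slack_ne_zero hO hOne K
  choose p hpA hp using fun i => hg i x (hOU hx)
  have hstrict : ∀ i, ∀ q ∈ A i, q ≠ p i → affineValue (p i) x < affineValue q x := by
    intro i q hq hne
    refine lt_of_le_of_ne (hp i ▸ hg' i x (hOU hx) q hq) fun h => ?_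
    refine hgen _ (hmemK i _ (hpA i) q hq) (fun h0 => hne (hA i q hq _ (hpA i) ?_)) ?_
    · exact sub_eq_zero.1 h0
    · rw [slack_sub, h, sub_self]
  have heq : ∀ y ∈ σ ∩ U, ∀ i, g i y = affineValue (p i) y := by
    intro y hy i
    obtain ⟨q, hq, hqy⟩ := hg i y hy.2
    refine le_antisymm (hg' i y hy.2 _ (hpA i)) ?_
    rw [hqy]
    by_cases hne : q = p i
    · rw [hne]
    · have := hOσ y hy x hx _ (hmemK i _ (hpA i) q hq)
      rw [slack_sub, slack_sub, sub_pos, sub_nonneg] at this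
      exact this (hstrict i q hq hne)
  refine ⟨_, ⟨_, fun i => (p i.succ).2 - (p 0).2, hmin x (hOU hx) p hpA hstrict, rfl⟩,
    fun y hy => ?_⟩
  ext i
  change g i.succ y - g 0 y = _
  rw [heq y ⟨hy, y.2⟩, heq y ⟨hy, y.2⟩]
  simp only [affineValue, affineMap, Matrix.mulVec, dotProduct, Pi.add_apply, Matrix.map_apply,
    Matrix.of_apply, Pi.sub_apply, Int.cast_sub, sub_mul, Finset.sum_sub_distrib]
  ring

end Arrangement

end TropicalAbelian

namespace TropicalAbelian

/-! ### The squared distance from a lattice -/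

section DistSq

variable {E L : Type*} [AddCommGroup E] [Module ℝ E] [AddCommGroup L]

/-- The squared distance of `-z` from the lattice `ι L`. -/
noncomputable def distSq (Q : E →ₗ[ℝ] E →ₗ[ℝ] ℝ) (ι : L →+ E) (z : E) : ℝ :=
  ⨅ u : L, Q (z + ι u) (z + ι u)

variable {Q : E →ₗ[ℝ] E →ₗ[ℝ] ℝ} {ι : L →+ E}

theorem distSq_add (z : E) (u : L) : distSq Q ι (z + ι u) = distSq Q ι z := by
  refine Eq.trans (iInf_congr fun v => ?_)
    ((Equiv.addLeft u).iInf_comp (g := fun v => Q (z + ι v) (z + ι v)))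
  rw [Equiv.coe_addLeft, AddMonoidHom.map_add, add_assoc]

variable (hsymm : ∀ x y, Q x y = Q y x) (hpos : ∀ x, x ≠ 0 → 0 < Q x x)
  (hfin : ∀ R, {u : L | Q (ι u) (ι u) ≤ R}.Finite)

include hpos in
theorem distSq_le (z : E) (u : L) : distSq Q ι z ≤ Q (z + ι u) (z + ι u) :=
  ciInf_le ⟨0, by rintro _ ⟨v, rfl⟩; exact form_self_nonneg hpos _⟩ u

include hpos in
theorem distSq_nonneg (z : E) : 0 ≤ distSq Q ι z :=
  le_ciInf fun _ => form_self_nonneg hpos _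

include hsymm hpos hfin in
theorem exists_distSq_eq (z : E) : ∃ u : L, distSq Q ι z = Q (z + ι u) (z + ι u) := by
  obtain ⟨u, hu⟩ := exists_form_add_min hsymm hpos hfin z
  exact ⟨u, le_antisymm (distSq_le hpos z u) (le_ciInf hu)⟩

include hpos in
-- Subtracting integer parts of coordinates moves `z` into the compact unit cube, where the form is
-- bounded.
theorem exists_distSq_le {n : ℕ} {e : Module.Basis (Fin n) ℤ L} {bR : Module.Basis (Fin n) ℝ E}
    (he : ∀ i, bR i = ι (e i)) : ∃ C, ∀ z, distSq Q ι z ≤ C := by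
  obtain ⟨C, hC⟩ := (isCompact_Icc (a := (0 : Fin n → ℝ)) (b := 1)).exists_bound_of_continuousOn
    (continuous_form_equivFun_symm Q bR).continuousOn
  refine ⟨C, fun z => ?_⟩
  let u : L := e.equivFun.symm fun i => -⌊bR.equivFun z i⌋
  have hz : z + ι u = bR.equivFun.symm fun i => Int.fract (bR.equivFun z i) := by
    have hu : e.equivFun u = fun i => -⌊bR.equivFun z i⌋ := e.equivFun.apply_symm_apply _
    rw [map_eq_equivFun_symm he, LinearEquiv.eq_symm_apply, map_add,
      LinearEquiv.apply_symm_apply, hu]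
    ext i
    simp only [Pi.add_apply, Int.cast_neg, Int.fract]
    ring
  calc distSq Q ι z ≤ Q (z + ι u) (z + ι u) := distSq_le hpos z u
    _ ≤ _ := le_abs_self _
    _ ≤ C := by
      rw [hz]
      exact hC _ ⟨fun i => Int.fract_nonneg _, fun i => (Int.fract_lt_one _).le⟩

include hsymm hpos hfin in
-- Choose nearest lattice vectors on the `y` side. Translated by a common `v`, they give upper
-- bounds on the `y'` side. The difference of the two quadratic functions is affine, so its weighted
-- sum is `k` times its value at the average `p`, a `k`-division point, where `h` applies.
theorem distSq_sum_le {k : ℕ} (hk : 3 ≤ k) {y y' : E} {κ : ℝ}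
    (h : ∀ u : L, distSq Q ι (y' + (k : ℝ)⁻¹ • ι u) = distSq Q ι (y + (k : ℝ)⁻¹ • ι u) + κ)
    (a b : E) :
    distSq Q ι (y' + a) + distSq Q ι (y' + b) + distSq Q ι (y' + (-a - b))
        + (k - 3) * distSq Q ι y' ≤
      distSq Q ι (y + a) + distSq Q ι (y + b) + distSq Q ι (y + (-a - b))
        + (k - 3) * distSq Q ι y + k * κ := by
  obtain ⟨u₁, h₁⟩ := exists_distSq_eq hsymm hpos hfin (y + a)
  obtain ⟨u₂, h₂⟩ := exists_distSq_eq hsymm hpos hfin (y + b)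
  obtain ⟨u₃, h₃⟩ := exists_distSq_eq hsymm hpos hfin (y + (-a - b))
  obtain ⟨u₄, h₄⟩ := exists_distSq_eq hsymm hpos hfin y
  let s : L := u₁ + u₂ + u₃ + (k - 3) • u₄
  obtain ⟨p, hps⟩ : ∃ p : E, p = (k : ℝ)⁻¹ • ι s := ⟨_, rfl⟩
  obtain ⟨v, hv⟩ := exists_distSq_eq hsymm hpos hfin (y' + p)
  have hk3 : (0 : ℝ) ≤ (k : ℝ) - 3 := sub_nonneg.2 (by exact_mod_cast hk)
  have hk0 : (0 : ℝ) ≤ k := by positivity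
  have hp : (k : ℝ) • p = (a + ι u₁) + (b + ι u₂) + ((-a - b) + ι u₃) + ((k : ℝ) - 3) • ι u₄ := by
    have : (k : ℝ) ≠ 0 := by positivity
    simp only [hps, s, smul_inv_smul₀ this, map_add, map_nsmul]
    rw [← Nat.cast_smul_eq_nsmul ℝ, Nat.cast_sub hk]
    push_cast
    abel
  have hdiff : ∀ t : E, Q (y' + ι v + t) (y' + ι v + t) - Q (y + t) (y + t) =
      Q (y' + ι v) (y' + ι v) - Q y y + 2 * Q (y' + ι v - y) t := fun t => by
    have := hsymm (y' + ι v) t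
    have := hsymm y t
    simp only [map_add, LinearMap.add_apply, map_sub, LinearMap.sub_apply] at *
    linarith
  have e := congrArg (Q (y' + ι v - y)) hp
  rw [map_add, map_add, map_add, map_smul, map_smul, smul_eq_mul, smul_eq_mul] at e
  have i₁ := distSq_le (ι := ι) hpos (y' + a) (u₁ + v)
  have i₂ := distSq_le (ι := ι) hpos (y' + b) (u₂ + v)
  have i₃ := distSq_le (ι := ι) hpos (y' + (-a - b)) (u₃ + v)
  have i₄ := mul_le_mul_of_nonneg_left (distSq_le (ι := ι) hpos y' (u₄ + v)) hk3
  have i₅ : distSq Q ι (y + p) ≤ Q (y + p) (y + p) := by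
    simpa only [map_zero, add_zero] using distSq_le (ι := ι) hpos (y + p) 0
  have hcomm : ∀ (c : E) (u : L), y' + c + ι (u + v) = y' + ι v + (c + ι u) := fun c u => by
    rw [map_add]
    abel
  have hcomm' : y' + ι (u₄ + v) = y' + ι v + ι u₄ := by
    rw [map_add]
    abel
  rw [hcomm] at i₁ i₂ i₃
  rw [hcomm'] at i₄
  rw [add_assoc] at h₁ h₂ h₃
  have d₁ := hdiff (a + ι u₁)
  have d₂ := hdiff (b + ι u₂)
  have d₃ := hdiff (-a - b + ι u₃)
  have d₄ := congrArg (((k : ℝ) - 3) * ·) (hdiff (ι u₄))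
  have d₅ := congrArg ((k : ℝ) * ·) (hdiff p)
  have hs := h s
  rw [← hps] at hs
  rw [hs, show y' + p + ι v = y' + ι v + p by abel] at hv
  have i₆ := mul_le_mul_of_nonneg_left (hv ▸ add_le_add_left i₅ κ) hk0
  rw [h₁, h₂, h₃, h₄]
  linarith

include hsymm hpos hfin in
/-- The differences of the squared distances from the translates of a lattice by the `k`-division
points, for `k ≥ 3`, separate the points modulo the lattice. -/
theorem exists_eq_add_of_distSq {k : ℕ} (hk : 3 ≤ k) (hC : ∃ C, ∀ z, distSq Q ι z ≤ C)
    {y y' : E} {κ : ℝ}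
    (h : ∀ u : L, distSq Q ι (y' + (k : ℝ)⁻¹ • ι u) = distSq Q ι (y + (k : ℝ)⁻¹ • ι u) + κ) :
    ∃ u : L, y' = y + ι u := by
  obtain ⟨C, hC⟩ := hC
  let F : E → ℝ := fun a => distSq Q ι (y' + a) - distSq Q ι (y + a)
  have hF : ∀ a b, F a + F b + F (-a - b) + (k - 3) * F 0 = k * κ := fun a b => by
    have h1 := distSq_sum_le hsymm hpos hfin hk h a b
    have h2 := distSq_sum_le hsymm hpos hfin hk (y := y') (y' := y) (κ := -κ)
      (fun u => by rw [h u]; ring) a b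
    simp only [F, add_zero]
    linarith
  -- Additivity is the difference of the identity `hF` at `(a, b)` and at `(a + b, 0)`.
  let G : E →+ ℝ := AddMonoidHom.mk' (fun a => F a - F 0) fun a b => by
    have h1 := hF a b
    have h2 := hF (a + b) 0
    rw [show -(a + b) - 0 = -a - b by abel] at h2
    linarith
  have hFC : ∀ a, |F a| ≤ C := fun a => by
    have h1 := hC (y' + a)
    have h2 := hC (y + a)
    have h3 := distSq_nonneg (ι := ι) hpos (y' + a)
    have h4 := distSq_nonneg (ι := ι) hpos (y + a)
    rw [abs_le]
    constructor <;> simp only [F] <;> linarith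
  have hG : ∀ a, G a = 0 := fun a => by
    by_contra hne
    obtain ⟨j, hj⟩ := exists_nat_gt (2 * C / |G a|)
    rw [div_lt_iff₀ (abs_pos.2 hne)] at hj
    have h1 : |G (j • a)| ≤ 2 * C := (abs_sub _ _).trans (by linarith [hFC (j • a), hFC 0])
    rw [map_nsmul, nsmul_eq_mul, abs_mul, Nat.abs_cast] at h1
    linarith
  -- `F (-y)` is a squared distance and `F (-y')` the negative of one, so equality forces both to
  -- vanish.
  have h1 : F (-y) = F (-y') := by
    have h1 : F (-y) - F 0 = 0 := hG (-y)
    have h2 : F (-y') - F 0 = 0 := hG (-y')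
    linarith
  have h0 : distSq Q ι 0 = 0 := le_antisymm (by simpa using distSq_le (ι := ι) hpos 0 0)
    (distSq_nonneg hpos 0)
  have h2 : distSq Q ι (y' + -y) = 0 := by
    have h3 := distSq_nonneg (ι := ι) hpos (y' + -y)
    have h4 := distSq_nonneg (ι := ι) hpos (y + -y')
    simp only [F, add_neg_cancel, h0] at h1
    linarith
  obtain ⟨u, hu⟩ := exists_distSq_eq hsymm hpos hfin (y' + -y)
  rw [h2] at hu
  have h3 : y' + -y + ι u = 0 := by
    by_contra hne
    exact (hpos _ hne).ne hu
  refine ⟨-u, ?_⟩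
  rw [map_neg, ← sub_eq_zero, ← h3]
  abel

end DistSq

/-! ### The maximal torus of tropical projective space -/

theorem TropicalProjectiveSpace.isOpenEmbedding_ofAffine (N : ℕ) :
    IsOpenEmbedding (ofAffine (N := N)) := by
  have hmk : IsQuotientMap (mk (N := N)) := isQuotientMap_quotient_mk'
  refine .of_continuous_injective_isOpenMap ?_ ?_ ?_
  · refine hmk.continuous.comp (Continuous.subtype_mk (continuous_pi fun i => ?_) _)
    exact WithTop.continuous_coe.comp (by refine Fin.cases ?_ (fun j => ?_) i <;> simp <;> fun_prop)
  · intro a a' h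
    obtain ⟨c, hc⟩ := Quotient.exact (s := tropicalProjectiveSetoid N) h
    have h0 := hc 0
    simp only [Fin.cons_zero, ← WithTop.coe_add, WithTop.coe_inj, add_zero] at h0
    ext i
    have := hc i.succ
    simp only [Fin.cons_succ, ← WithTop.coe_add, WithTop.coe_inj, ← h0, zero_add] at this
    exact this.symm
  · intro W hW
    rw [← hmk.isOpen_preimage]
    let O : Set (HomogeneousCoord N) := {a | ∀ i, a.1 i ≠ ⊤}
    let r : HomogeneousCoord N → (Fin N → ℝ) := fun a i =>
      (a.1 i.succ).untopD 0 - (a.1 0).untopD 0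
    have hO : IsOpen O := by
      have : O = ⋂ i, {a | a.1 i ≠ ⊤} := by
        ext a
        simp [O]
      rw [this]
      exact isOpen_iInter_of_finite fun i => isOpen_ne.preimage
        ((continuous_apply i).comp continuous_subtype_val)
    have hr : ContinuousOn r O := by
      have hc : ∀ i, ContinuousOn (fun a : HomogeneousCoord N => (a.1 i).untopD 0) O := fun i =>
        (WithTop.continuousOn_untopD 0).comp
          ((continuous_apply i).comp continuous_subtype_val).continuousOn fun a ha => ha i
      exact continuousOn_pi.2 fun i => (hc i.succ).sub (hc 0)
    -- Normalizing the zeroth coordinate to zero describes the saturated preimage.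
    have : mk ⁻¹' (ofAffine '' W) = O ∩ r ⁻¹' W := by
      ext a
      constructor
      · rintro ⟨w, hw, h⟩
        obtain ⟨c, hc⟩ := Quotient.exact (s := tropicalProjectiveSetoid N) h
        refine ⟨fun i => ?_, ?_⟩
        · rw [hc i, ← WithTop.coe_add]
          exact WithTop.coe_ne_top
        · have : r a = w := by
            ext i
            simp only [r, hc, ← WithTop.coe_add, WithTop.untopD_coe]
            simp
          rwa [mem_preimage, this]
      · rintro ⟨ha, hw⟩
        refine ⟨_, hw, Quotient.sound (s := tropicalProjectiveSetoid N)
          ⟨(a.1 0).untopD 0, fun i => ?_⟩⟩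
        have hcoe : ∀ i, a.1 i = (((a.1 i).untopD 0 : ℝ) : WithTop ℝ) := fun i => by
          obtain ⟨x, hx⟩ := WithTop.ne_top_iff_exists.1 (ha i)
          rw [← hx, WithTop.untopD_coe]
        rw [hcoe i, ← WithTop.coe_add, WithTop.coe_inj]
        refine Fin.cases ?_ (fun j => ?_) i <;> simp [r]
    rw [this]
    exact hr.isOpen_inter_preimage hO hW

end TropicalAbelian

/-! ### Theta functions as distances from the lattice -/

namespace TropicalAbelian

variable {M M' : Type*} [AddCommGroup M] [AddCommGroup M']

theorem RealTorus.compactSpace (T : RealTorus M M') {n : ℕ} (e : Module.Basis (Fin n) ℤ M') :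
    CompactSpace T.Space := by
  let bR := T.isBaseChange.basis e
  have hcont : Continuous fun v : Fin n → ℝ => T.proj (bR.equivFun.symm v) :=
    T.continuous_proj.comp
      (LinearMap.continuous_of_finiteDimensional bR.equivFun.symm.toLinearMap)
  refine ⟨?_⟩
  convert (isCompact_Icc (a := (0 : Fin n → ℝ)) (b := 1)).image hcont
  refine (eq_univ_of_forall fun y => ?_).symm
  obtain ⟨x, rfl⟩ := T.proj_surjective y
  refine ⟨fun i => Int.fract (bR.equivFun x i),
    ⟨fun i => Int.fract_nonneg _, fun i => (Int.fract_lt_one _).le⟩, T.proj_eq_iff.2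
      ⟨e.equivFun.symm fun i => ⌊bR.equivFun x i⌋, ?_⟩⟩
  have h := map_eq_equivFun_symm (e := e) (bR := bR) (ι := T.incl.toAddMonoidHom)
    (fun i => IsBaseChange.basis_apply e T.isBaseChange i)
    (e.equivFun.symm fun i => ⌊bR.equivFun x i⌋)
  rw [LinearEquiv.apply_symm_apply] at h
  change T.incl _ = _ at h
  rw [h, ← map_add, LinearEquiv.eq_symm_apply]
  ext i
  simp only [Pi.add_apply, Int.fract]
  ring

namespace TropicalDescentDatum

variable {T : RealTorus M M'} {D : TropicalDescentDatum T}

/-- The inclusion of the lattice as a homomorphism of abelian groups. -/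
abbrev latticeHom (T : RealTorus M M') : M' →+ NR M := T.incl.toAddMonoidHom

/-- The left side of the cocycle identity is symmetric in the two lattice vectors; a basis of `M'`
is a real basis of `N_ℝ`. -/
theorem form_symm {n : ℕ} (e : Module.Basis (Fin n) ℤ M') (x y : NR M) :
    D.form x y = D.form y x := by
  have : D.form = D.form.flip := by
    refine (T.isBaseChange.basis e).ext fun i => (T.isBaseChange.basis e).ext fun j => ?_
    have h1 := D.cocycle (e i) (e j)
    have h2 := D.cocycle (e j) (e i)
    rw [add_comm (e j)] at h2
    simp only [IsBaseChange.basis_apply, LinearMap.flip_apply, form_incl]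
    linarith
  exact congrArg (fun S => S x y) this

theorem IsPolarization.exists_form_eq (hD : D.IsPolarization) [Module.Free ℤ M']
    [Module.Finite ℤ M'] (l : NR M →ₗ[ℝ] ℝ) : ∃ r, D.form r = l := by
  have : FiniteDimensional ℝ (NR M) :=
    Module.Finite.of_basis (T.isBaseChange.basis (Module.Free.chooseBasis ℤ M'))
  have hS : Function.Injective D.form := by
    rw [injective_iff_map_eq_zero]
    intro y hy
    by_contra hne
    have h1 := hD y hne
    rw [hy] at h1
    exact lt_irrefl _ h1
  exact (LinearMap.injective_iff_surjective_of_finrank_eq_finrank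
    (Subspace.dual_finrank_eq (K := ℝ) (V := NR M)).symm).1 hS l

theorem IsPolarization.form_injective (hD : D.IsPolarization) {r s : NR M}
    (h : ∀ x, D.form r x = D.form s x) : r = s := by
  by_contra hne
  have h1 := hD (r - s) (sub_ne_zero.2 hne)
  simp only [map_sub, LinearMap.sub_apply, h, sub_self, lt_self_iff_false] at h1

/-- The embedding of `M` into `N_ℝ` given by the polarization. -/
theorem IsPolarization.exists_dualVec (hD : D.IsPolarization) [Module.Free ℤ M']
    [Module.Finite ℤ M'] : ∃ h : M →+ NR M, (∀ b x, D.form (h b) x = x b) ∧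
      ∀ u, h (D.lam u) = T.incl u := by
  choose h hh using fun b : M => hD.exists_form_eq
    { toFun := fun x : NR M => x b, map_add' := fun _ _ => rfl, map_smul' := fun _ _ => rfl }
  have key : ∀ b x, D.form (h b) x = x b := fun b x => by rw [hh]; rfl
  refine ⟨AddMonoidHom.mk' h fun a b => hD.form_injective fun x => ?_, key, fun u =>
    hD.form_injective fun x => ?_⟩
  · simp [key]
  · rw [form_incl]
    exact key _ _

/-- By the cocycle identity `γ` minus half the quadratic form is additive, hence represented by a
vector. -/
theorem IsPolarization.exists_center (hD : D.IsPolarization) [Module.Free ℤ M']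
    [Module.Finite ℤ M'] : ∃ c, ∀ u, D.form c (T.incl u) =
      D.gam u - 1 / 2 * D.form (T.incl u) (T.incl u) := by
  let L : M' →+ ℝ :=
    AddMonoidHom.mk' (fun u => D.gam u - 1 / 2 * T.incl u (D.lam u)) fun u v => by
        have h1 := D.cocycle u v
        have h2 := D.cocycle v u
        rw [add_comm v u] at h2
        simp only [map_add, LinearMap.add_apply]
        linarith
  obtain ⟨c, hc⟩ := hD.exists_form_eq (T.isBaseChange.lift L.toIntLinearMap)
  refine ⟨c, fun u => ?_⟩
  rw [hc, T.isBaseChange.lift_eq, form_incl]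
  rfl

/-- The objects that express theta functions by distances from the lattice. -/
structure IsCentered (D : TropicalDescentDatum T) (h : M →+ NR M) (c : NR M) : Prop where
  form_apply : ∀ b x, D.form (h b) x = x b
  map_lam : ∀ u, h (D.lam u) = T.incl u
  form_center : ∀ u, D.form c (T.incl u) = D.gam u - 1 / 2 * D.form (T.incl u) (T.incl u)

theorem IsPolarization.exists_isCentered (hD : D.IsPolarization) [Module.Free ℤ M']
    [Module.Finite ℤ M'] : ∃ h c, IsCentered D h c := by
  obtain ⟨h, h1, h2⟩ := hD.exists_dualVec
  obtain ⟨c, hc⟩ := hD.exists_center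
  exact ⟨h, c, h1, h2, hc⟩

theorem finite_form_incl_le {n : ℕ} (e : Module.Basis (Fin n) ℤ M') (hD : D.IsPolarization)
    (R : ℝ) : {u : M' | D.form (latticeHom T u) (latticeHom T u) ≤ R}.Finite :=
  finite_form_le e (T.isBaseChange.basis e) (fun i => IsBaseChange.basis_apply e _ i) hD R

section Centered

variable {h : M →+ NR M} {c : NR M} (hc : IsCentered D h c)
  (hsymm : ∀ x y, D.form x y = D.form y x)

include hc hsymm in
-- Completing the square. The correction is independent of `u`, and is a sum of a term in `x` and a
-- term in `b`.
theorem IsCentered.thetaTerm_eq (b : M) (x : NR M) (u : M') :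
    D.thetaTerm b x u = 1 / 2 * D.form (h b + x + c + latticeHom T u) (h b + x + c + latticeHom T u)
      - (1 / 2 * D.form (x + c) (x + c) + (1 / 2 * D.form (h b) (h b) + D.form (h b) c)) := by
  have e : latticeHom T u = T.incl u := rfl
  have h1 := hc.form_center u
  have h2 := hc.form_apply b x
  have h3 := hc.form_apply b (T.incl u)
  have h4 := D.form_incl u x
  have s1 := hsymm x c
  have s2 := hsymm (h b) x
  have s3 := hsymm (h b) c
  have s4 := hsymm (h b) (T.incl u)
  have s5 := hsymm x (T.incl u)
  have s6 := hsymm c (T.incl u)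
  rw [e]
  simp only [thetaTerm, map_add, LinearMap.add_apply]
  linarith

include hc hsymm in
theorem IsCentered.thetaTerm_le_iff (b : M) (x : NR M) (u v : M') :
    D.thetaTerm b x u ≤ D.thetaTerm b x v ↔
      D.form (h b + x + c + latticeHom T u) (h b + x + c + latticeHom T u) ≤
        D.form (h b + x + c + latticeHom T v) (h b + x + c + latticeHom T v) := by
  rw [hc.thetaTerm_eq hsymm, hc.thetaTerm_eq hsymm]
  constructor <;> intro <;> linarith

theorem theta_eq_of_forall_le {b : M} {x : NR M} {u : M'}
    (hu : ∀ v, D.thetaTerm b x u ≤ D.thetaTerm b x v) : D.theta b x = D.thetaTerm b x u :=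
  le_antisymm (ciInf_le ⟨_, by rintro _ ⟨v, rfl⟩; exact hu v⟩ u) (le_ciInf hu)

theorem theta_le_of_forall_le {b : M} {x : NR M} {u : M'}
    (hu : ∀ v, D.thetaTerm b x u ≤ D.thetaTerm b x v) (v : M') :
    D.theta b x ≤ D.thetaTerm b x v :=
  (theta_eq_of_forall_le hu).trans_le (hu v)

variable (hD : D.IsPolarization) {n : ℕ} (e : Module.Basis (Fin n) ℤ M')

include hc e hD in
theorem IsCentered.exists_forall_thetaTerm_le (b : M) (x : NR M) :
    ∃ u, ∀ v, D.thetaTerm b x u ≤ D.thetaTerm b x v := by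
  obtain ⟨u, hu⟩ := exists_form_add_min (form_symm e) hD (finite_form_incl_le e hD) (h b + x + c)
  exact ⟨u, fun v => (hc.thetaTerm_le_iff (form_symm e) b x u v).2 (hu v)⟩

include hc e hD in
theorem IsCentered.theta_eq (b : M) (x : NR M) :
    D.theta b x = 1 / 2 * distSq D.form (latticeHom T) (h b + x + c)
      - (1 / 2 * D.form (x + c) (x + c) + (1 / 2 * D.form (h b) (h b) + D.form (h b) c)) := by
  obtain ⟨u, hu⟩ := hc.exists_forall_thetaTerm_le hD e b x
  have h1 : distSq D.form (latticeHom T) (h b + x + c) =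
      D.form (h b + x + c + latticeHom T u) (h b + x + c + latticeHom T u) :=
    le_antisymm (distSq_le hD _ u)
      (le_ciInf fun v => (hc.thetaTerm_le_iff (form_symm e) b x u v).1 (hu v))
  rw [theta_eq_of_forall_le hu, hc.thetaTerm_eq (form_symm e), h1]

theorem IsCompleteSystem.exists_eq_add {ι : Type*} {b : ι → M} (hb : D.IsCompleteSystem b)
    (m : M) : ∃ i u, m = b i + D.lam u := by
  obtain ⟨i, hi⟩ := hb.2 (Submodule.Quotient.mk m)
  obtain ⟨u, hu⟩ := (Submodule.Quotient.eq _).1 hi.symm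
  exact ⟨i, u, by rw [hu]; abel⟩

include hc in
theorem IsCentered.map_div {k : ℕ} (hk : 0 < k) {m : M} {u : M'} (hm : k • m = D.lam u) :
    h m = (k : ℝ)⁻¹ • latticeHom T u := by
  have h0 : (k : ℝ) ≠ 0 := by positivity
  rw [eq_inv_smul_iff₀ h0, Nat.cast_smul_eq_nsmul, ← map_nsmul, hm, hc.map_lam]
  rfl

include hc e hD in
theorem IsCentered.proj_eq_of_theta {ι : Type*} {b : ι → M} (hb : D.IsCompleteSystem b)
    {k : ℕ} (hk : 3 ≤ k) (hdiv : ∀ u, ∃ m : M, k • m = D.lam u) {x x' : NR M} {κ : ℝ}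
    (hx : ∀ i, D.theta (b i) x' = D.theta (b i) x + κ) : T.proj x = T.proj x' := by
  obtain ⟨u, hu⟩ := exists_eq_add_of_distSq (form_symm e) hD (finite_form_incl_le e hD) hk
    (exists_distSq_le hD (e := e) (bR := T.isBaseChange.basis e)
      fun i => IsBaseChange.basis_apply e _ i) (y := x + c) (y' := x' + c)
    (κ := 2 * κ + D.form (x' + c) (x' + c) - D.form (x + c) (x + c)) fun u => by
      obtain ⟨m, hm⟩ := hdiv u
      rw [← hc.map_div (by omega) hm]
      -- Changing the representative modulo `λ(M')` shifts `h m` by a lattice vector, which leaves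
      -- the distance unchanged.
      obtain ⟨i, v, rfl⟩ := hb.exists_eq_add m
      have h1 := hx i
      rw [hc.theta_eq hD e, hc.theta_eq hD e] at h1
      have h2 : ∀ y, y + c + h (b i + D.lam v) = h (b i) + y + c + latticeHom T v := fun y => by
        rw [map_add, hc.map_lam]
        change _ = h (b i) + y + c + T.incl v
        abel
      rw [h2, h2, distSq_add, distSq_add]
      linarith
  refine T.proj_eq_iff.2 ⟨u, ?_⟩
  have : x' + c = x + T.incl u + c := hu.trans (by
    change x + c + T.incl u = _
    abel)
  exact add_right_cancel this

include e in
theorem continuous_form_self : Continuous fun x : NR M => D.form x x := by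
  let bR := T.isBaseChange.basis e
  have : FiniteDimensional ℝ (NR M) := Module.Finite.of_basis bR
  have := (continuous_form_equivFun_symm D.form bR).comp
    (LinearMap.continuous_of_finiteDimensional bR.equivFun.toLinearMap)
  simpa only [Function.comp_def, LinearEquiv.coe_coe, LinearEquiv.symm_apply_apply] using this

include hc e hD in
/-- Locally only finitely many terms contribute to the theta functions. -/
theorem IsCentered.exists_nhds_finset {ι : Type*} [Finite ι] (b : ι → M) (x₀ : NR M) :
    ∃ V : Set (NR M), IsOpen V ∧ x₀ ∈ V ∧ ∃ A : Finset M', ∀ x ∈ V, ∀ i u,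
      (∀ v, D.thetaTerm (b i) x u ≤ D.thetaTerm (b i) x v) → u ∈ A := by
  let q : ι → NR M → ℝ := fun i x => D.form (h (b i) + x + c) (h (b i) + x + c)
  have hq : ∀ i, Continuous (q i) := fun i =>
    (continuous_form_self e).comp ((continuous_const.add continuous_id).add continuous_const)
  have hA : (⋃ i, {u : M' | D.form (latticeHom T u) (latticeHom T u) ≤ 4 * (q i x₀ + 1)}).Finite :=
    Set.finite_iUnion fun i => finite_form_incl_le e hD _
  refine ⟨⋂ i, {x | q i x < q i x₀ + 1}, isOpen_iInter_of_finite fun i =>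
    isOpen_lt (hq i) continuous_const, mem_iInter.2 fun i => lt_add_one (q i x₀), hA.toFinset,
    fun x hx i u hu => ?_⟩
  rw [Set.Finite.mem_toFinset]
  refine mem_iUnion.2 ⟨i, ?_⟩
  -- Comparison with the term `u = 0` bounds the norm of a minimizer by four times `q i x`.
  have h1 := (hc.thetaTerm_le_iff (form_symm e) (b i) x u 0).1 (hu 0)
  rw [map_zero, add_zero] at h1
  have h2 := form_le_of_form_add_le (form_symm e) hD _ _ h1
  have h3 : q i x < q i x₀ + 1 := mem_iInter.1 hx i
  exact h2.trans (by change 4 * q i x ≤ _; linarith)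

theorem continuous_thetaTerm (b : M) (u : M') : Continuous fun x => D.thetaTerm b x u := by
  unfold thetaTerm
  exact ((continuous_eval _).add continuous_const).add continuous_const

include hc e hD in
theorem IsCentered.continuous_theta (b : M) : Continuous (D.theta b) := by
  refine continuous_iff_continuousAt.2 fun x₀ => ?_
  obtain ⟨V, hV, hx₀, A, hA⟩ := hc.exists_nhds_finset hD e (fun _ : Unit => b) x₀
  obtain ⟨u₀, hu₀⟩ := hc.exists_forall_thetaTerm_le hD e b x₀
  have hne : A.Nonempty := ⟨u₀, hA x₀ hx₀ () u₀ hu₀⟩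
  have hcont : Continuous fun x => A.inf' hne fun u => D.thetaTerm b x u :=
    Continuous.finset_inf'_apply hne fun u _ => continuous_thetaTerm b u
  refine hcont.continuousAt.congr (Filter.eventuallyEq_of_mem (hV.mem_nhds hx₀) fun x hx => ?_)
  obtain ⟨u, hu⟩ := hc.exists_forall_thetaTerm_le hD e b x
  simp only [theta_eq_of_forall_le hu]
  exact le_antisymm (Finset.inf'_le _ (hA x hx () u hu)) (Finset.le_inf' hne _ fun v _ => hu v)

include hc e in
/-- The differences of the linear parts of the theta functions at a generic point generate `M`. -/
theorem IsCentered.span_sub_eq_top {N : ℕ} {b : Fin (N + 1) → M} (hb : D.IsCompleteSystem b)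
    {k : ℕ} (hk : 0 < k) (δ : M' →+ M) (hδ : ∀ u, k • δ u = D.lam u)
    (hgen : ∀ (z : NR M) (H : AddSubgroup M'), (∀ u u' : M',
      z + latticeHom T u ∈ voronoi D.form (latticeHom T) k →
      z + latticeHom T u' ∈ voronoi D.form (latticeHom T) k → u - u' ∈ H) → H = ⊤)
    (x : NR M) (u : Fin (N + 1) → M')
    (hu : ∀ i v, v ≠ u i → D.thetaTerm (b i) x (u i) < D.thetaTerm (b i) x v) :
    Submodule.span ℤ (range fun i : Fin N =>
      (b i.succ + D.lam (u i.succ)) - (b 0 + D.lam (u 0))) = ⊤ := by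
  set G := Submodule.span ℤ (range fun i : Fin N =>
    (b i.succ + D.lam (u i.succ)) - (b 0 + D.lam (u 0))) with hG
  have h0 : ∀ i, (b i + D.lam (u i)) - (b 0 + D.lam (u 0)) ∈ G := fun i => by
    refine Fin.cases ?_ (fun j => ?_) i
    · rw [sub_self]
      exact G.zero_mem
    · exact Submodule.subset_span ⟨j, rfl⟩
  have hk0 : (k : ℝ) ≠ 0 := by positivity
  -- Division by `k` makes `h (δ w) + x + c` a shortest vector of its class modulo `M'`. By
  -- uniqueness of minimizers `δ w` is then one of the linear parts.
  have hgood : ∀ w : M', (k : ℝ) • (x + c) + latticeHom T w ∈ voronoi D.form (latticeHom T) k →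
      ∃ i, δ w = b i + D.lam (u i) := fun w hw => by
    obtain ⟨i, v, hv⟩ := hb.exists_eq_add (δ w)
    have h1 := smul_mem_voronoi (r := (k : ℝ)⁻¹) (by positivity) hw
    rw [inv_mul_cancel₀ hk0, smul_add, inv_smul_smul₀ hk0, ← hc.map_div hk (hδ w), hv, map_add,
      hc.map_lam, show x + c + (h (b i) + T.incl v) = h (b i) + x + c + latticeHom T v by
        change _ = h (b i) + x + c + T.incl v
        abel] at h1
    refine ⟨i, ?_⟩
    by_contra hne
    have hvu : u i ≠ v := fun h => hne (by rw [hv, h])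
    refine (hu i v hvu.symm).not_ge ((hc.thetaTerm_le_iff (form_symm e) _ _ _ _).2 ?_)
    have h2 := (mem_voronoi_one (form_symm e)).1 h1 (u i - v)
    rwa [add_assoc (h (b i) + x + c), ← map_add, add_sub_cancel] at h2
  have htop : G.toAddSubgroup.comap δ = ⊤ := hgen ((k : ℝ) • (x + c)) _ fun w w' hw hw' => by
    obtain ⟨i, hi⟩ := hgood w hw
    obtain ⟨j, hj⟩ := hgood w' hw'
    change δ (w - w') ∈ G
    rw [map_sub, hi, hj]
    convert G.sub_mem (h0 i) (h0 j) using 1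
    abel
  have hlam : ∀ w, D.lam w ∈ G := fun w => by
    have h1 : w ∈ G.toAddSubgroup.comap δ := htop ▸ AddSubgroup.mem_top w
    rw [← hδ]
    exact nsmul_mem (show δ w ∈ G from h1) k
  -- Once `λ(M')` lies in `G`, it suffices to represent every class modulo `λ(M')`, which the
  -- complete system does.
  refine eq_top_iff.2 fun m _ => ?_
  obtain ⟨i, v, hv⟩ := hb.exists_eq_add (m + (b 0 + D.lam (u 0)))
  have h1 : m = (b i + D.lam (u i)) - (b 0 + D.lam (u 0)) + D.lam (v - u i) := by
    rw [eq_sub_of_add_eq hv, map_sub]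
    abel
  rw [h1]
  exact G.add_mem (h0 i) (hlam _)

end Centered

end TropicalDescentDatum

end TropicalAbelian

/-! ### Charts of the torus and generic unimodularity -/

namespace TropicalAbelian

variable {M M' : Type*} [AddCommGroup M] [AddCommGroup M']

namespace RealTorus

variable {T : RealTorus M M'}

theorem target_chart {n : ℕ} (B : Module.Basis (Fin n) ℤ M) {V : Set (NR M)} (hV : IsOpen V)
    (hinj : InjOn T.proj V) : (chart B hV hinj).target = coordHomeo B '' V := by
  ext v
  constructor
  · rintro ⟨y, rfl⟩
    exact ⟨_, (localSection hV hinj y).2, rfl⟩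
  · rintro ⟨x, hx, rfl⟩
    exact ⟨(localSection hV hinj).symm ⟨x, hx⟩,
      congrArg (coordHomeo B) (congrArg Subtype.val ((localSection hV hinj).apply_symm_apply _))⟩

theorem homeo_symm_chart {n : ℕ} (B : Module.Basis (Fin n) ℤ M) {V : Set (NR M)} (hV : IsOpen V)
    (hinj : InjOn T.proj V) (y : (chart B hV hinj).target) :
    ((chart B hV hinj).homeo.symm y : T.Space) = T.proj ((coordHomeo B).symm y.1) := by
  have h1 : ((chart B hV hinj).homeo ((chart B hV hinj).homeo.symm y)).1 = y.1 := by
    rw [Homeomorph.apply_symm_apply]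
  have h2 : coordHomeo B (localSection hV hinj ((chart B hV hinj).homeo.symm y)) = y.1 := h1
  refine (proj_localSection hV hinj ((chart B hV hinj).homeo.symm y)).symm.trans ?_
  exact congrArg T.proj ((coordHomeo B).symm_apply_eq.2 h2.symm).symm

theorem isAtlasOf_of_subset [Module.Free ℤ M'] [Module.Finite ℤ M'] [Module.Free ℤ M]
    [Module.Finite ℤ M] {A : Set (PolyhedralChart T.Space)} (hA : A ⊆ T.canonicalAtlas)
    (hcover : ∀ x, ∃ c ∈ A, x ∈ c.source) : IsAtlasOf T.Space A := by
  have h := RationalPolyhedralSpace.isAtlas (X := T.Space)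
  have hA' : A ∪ RationalPolyhedralSpace.atlas (X := T.Space) =
    RationalPolyhedralSpace.atlas (X := T.Space) := union_eq_right.2 hA
  exact ⟨⟨hcover, fun c hc c' hc' => h.transition c (hA hc) c' (hA hc')⟩, by rwa [hA']⟩

end RealTorus

namespace TropicalDescentDatum

variable {T : RealTorus M M'} {D : TropicalDescentDatum T}

theorem HasType.exists_div {n : ℕ} {d : Fin n → ℕ} (hd : D.HasType d) (hn : 0 < n) :
    ∃ δ : M' →+ M, ∀ u, d ⟨0, hn⟩ • δ u = D.lam u := by
  obtain ⟨-, hdvd, B', B, hB⟩ := hd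
  choose q hq using fun i => hdvd ⟨0, hn⟩ i (Nat.zero_le _)
  let δ : M' →ₗ[ℤ] M := B'.constr ℤ fun i => q i • B i
  refine ⟨δ.toAddMonoidHom, fun u => ?_⟩
  have : d ⟨0, hn⟩ • δ = D.lam := B'.ext fun i => by
    rw [LinearMap.smul_apply, Module.Basis.constr_basis, smul_smul, ← hq, hB]
  rw [← this]
  rfl

/-- For `n ≥ 3` the bound gives `k ≥ 4`, so the general argument applies; in ranks one and two it
only gives `k ≥ 2`. -/
theorem eq_top_of_voronoi {n : ℕ} (e : Module.Basis (Fin n) ℤ M') (hD : D.IsPolarization)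
    (hn : 0 < n) {k : ℕ} (hk : 2 * (n - 1).factorial ≤ k) (z : NR M) (H : AddSubgroup M')
    (hH : ∀ u u' : M', z + latticeHom T u ∈ voronoi D.form (latticeHom T) k →
      z + latticeHom T u' ∈ voronoi D.form (latticeHom T) k → u - u' ∈ H) : H = ⊤ := by
  have hfin := finite_form_incl_le e hD
  have hspan : AddSubgroup.closure (range e) = ⊤ := 
    (AddSubgroup.eq_top_iff' _).2 fun u => by
      have hu := e.mem_span u
      rwa [← Submodule.mem_toAddSubgroup, Submodule.span_int_eq_addSubgroupClosure] at hu
  have hspanR := (T.isBaseChange.basis e).span_eq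
  have hbR : ∀ i, T.isBaseChange.basis e i = latticeHom T (e i) :=
    fun i => IsBaseChange.basis_apply e _ i
  by_cases h3 : 3 ≤ n
  · refine eq_top_of_three_le (form_symm e) hD hfin (k := k) ?_ z hH
    have h1 := Nat.self_le_factorial (n - 1)
    exact_mod_cast (by omega : 3 ≤ k)
  · have hk2 : (2 : ℝ) ≤ k := by
      have h1 := Nat.factorial_pos (n - 1)
      exact_mod_cast (by omega : 2 ≤ k)
    obtain rfl | rfl : n = 1 ∨ n = 2 := by omega
    · refine eq_top_of_rank_one hD hk2 (a := e 0) ?_ z ?_ hH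
      · rw [← hspan, range_unique]
        rfl
      · have h1 : z ∈ Submodule.span ℝ (range (T.isBaseChange.basis e)) := hspanR ▸ trivial
        rw [range_unique, Submodule.mem_span_singleton] at h1
        obtain ⟨s, hs⟩ := h1
        exact ⟨s, by rw [← hs, hbR]; rfl⟩
    · refine eq_top_of_rank_two (form_symm e) hD hfin hk2 (a₀ := e 0) (b₀ := e 1) ?_ z ?_ hH
      · rw [← hspan]
        congr 1
        ext u
        simp [Fin.exists_fin_two, eq_comm]
      · have h1 : z ∈ Submodule.span ℝ (range (T.isBaseChange.basis e)) := hspanR ▸ trivial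
        refine Submodule.span_mono ?_ h1
        rintro _ ⟨i, rfl⟩
        exact ⟨e i, (hbR i).symm⟩

theorem thetaTerm_coordHomeo_symm {n : ℕ} (B : Module.Basis (Fin n) ℤ M) (b : M)
    (v : Fin n → ℝ) (u : M') : D.thetaTerm b ((coordHomeo B).symm v) u =
      affineValue (⇑(B.repr (b + D.lam u)), D.gam u + T.incl u b) v := by
  simp [thetaTerm, affineValue, coordHomeo, Module.Basis.constr_apply_fintype, add_assoc]

variable {h : M →+ NR M} {c : NR M} (hc : IsCentered D h c) (hD : D.IsPolarization) {n : ℕ}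
  (e : Module.Basis (Fin n) ℤ M')

include hc hD e in
theorem IsCentered.isUnimodularOn (B : Module.Basis (Fin n) ℤ M) {N : ℕ}
    {b : Fin (N + 1) → M} {U : Set (Fin n → ℝ)} (hU : IsOpen U) (hconv : Convex ℝ U)
    (hne : U.Nonempty) (A : Finset M')
    (hA : ∀ v ∈ U, ∀ i u, (∀ w, D.thetaTerm (b i) ((coordHomeo B).symm v) u ≤
      D.thetaTerm (b i) ((coordHomeo B).symm v) w) → u ∈ A)
    (hspan : ∀ (x : NR M) (u : Fin (N + 1) → M'),
      (∀ i v, v ≠ u i → D.thetaTerm (b i) x (u i) < D.thetaTerm (b i) x v) →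
      Submodule.span ℤ (range fun i : Fin N =>
        (b i.succ + D.lam (u i.succ)) - (b 0 + D.lam (u 0))) = ⊤) :
    IsUnimodularOn fun (v : U) (i : Fin N) => D.theta (b i.succ) ((coordHomeo B).symm v) -
      D.theta (b 0) ((coordHomeo B).symm v) := by
  classical
  let p : Fin (N + 1) → M' → (Fin n → ℤ) × ℝ := fun i u =>
    (⇑(B.repr (b i + D.lam u)), D.gam u + T.incl u (b i))
  have hp : ∀ i v u, D.thetaTerm (b i) ((coordHomeo B).symm v) u = affineValue (p i u) v :=
    fun i v u => thetaTerm_coordHomeo_symm B (b i) v u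
  have hpinj : ∀ i u w, (p i u).1 = (p i w).1 → u = w := fun i u w huw => by
    have h1 : D.lam u = D.lam w :=
      add_left_cancel (B.repr.injective (DFunLike.coe_injective huw))
    have h2 : T.incl u = T.incl w := by rw [← hc.map_lam, ← hc.map_lam, h1]
    refine e.ext_elem fun i => ?_
    have h3 := IsBaseChange.basis_repr_comp_apply e T.isBaseChange u i
    rw [h2, IsBaseChange.basis_repr_comp_apply e T.isBaseChange w i] at h3
    exact (Int.cast_injective (α := ℝ) h3).symm
  refine isUnimodularOn_of_min hU hconv hne (fun i => A.image (p i)) ?_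
    (fun i v => D.theta (b i) ((coordHomeo B).symm v)) ?_ ?_ ?_
  · intro i q hq r hr hqr
    obtain ⟨u, -, rfl⟩ := Finset.mem_image.1 hq
    obtain ⟨w, -, rfl⟩ := Finset.mem_image.1 hr
    rw [hpinj i u w hqr]
  · intro i v hv
    obtain ⟨u, hu⟩ := hc.exists_forall_thetaTerm_le hD e (b i) ((coordHomeo B).symm v)
    exact ⟨p i u, Finset.mem_image_of_mem _ (hA v hv i u hu),
      (theta_eq_of_forall_le hu).trans (hp i v u)⟩
  · intro i v _ q hq
    obtain ⟨w, -, rfl⟩ := Finset.mem_image.1 hq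
    obtain ⟨u, hu⟩ := hc.exists_forall_thetaTerm_le hD e (b i) ((coordHomeo B).symm v)
    exact (theta_le_of_forall_le hu w).trans_eq (hp i v w)
  · intro v hv q hq hmin
    choose u huA hu using fun i => Finset.mem_image.1 (hq i)
    obtain rfl : (fun i => p i (u i)) = q := funext hu
    have hlt : ∀ i, ∀ w ∈ A, w ≠ u i → D.thetaTerm (b i) ((coordHomeo B).symm v) (u i) <
        D.thetaTerm (b i) ((coordHomeo B).symm v) w := fun i w hw hne => by
      rw [hp, hp]
      exact hmin i _ (Finset.mem_image_of_mem _ hw) fun h => hne (hpinj i _ _ (congrArg _ h))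
    -- All minimizers lie in `A`, so strict minimality within `A` extends to the whole lattice.
    have hlt' : ∀ i w, w ≠ u i → D.thetaTerm (b i) ((coordHomeo B).symm v) (u i) <
        D.thetaTerm (b i) ((coordHomeo B).symm v) w := fun i w hne => by
      obtain ⟨u', hu'⟩ := hc.exists_forall_thetaTerm_le hD e (b i) ((coordHomeo B).symm v)
      obtain rfl : u' = u i := by
        by_contra h
        exact (hlt i u' (hA v hv i u' hu') h).not_ge (hu' _)
      refine lt_of_le_of_ne (hu' w) fun h => ?_
      exact (hlt i w (hA v hv i w fun w' => h ▸ hu' w') hne).ne h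
    apply isUnimodularMatrix_of_span_eq_top
    have h1 := congrArg (Submodule.map B.equivFun.toLinearMap) (hspan _ u hlt')
    rw [Submodule.map_span, ← range_comp, Submodule.map_top, LinearEquiv.range] at h1
    rw [← h1]
    exact congrArg (fun s => Submodule.span ℤ s) (congrArg range (funext fun i => funext fun j => by
      simp [p]))

/-! ### The theta map on the torus -/

variable [Module.Free ℤ M'] [Module.Finite ℤ M']

/-- The choice of lift is harmless: the factor of automorphy is the same for all `b` and cancels in
differences. -/
noncomputable def affineThetaMap (D : TropicalDescentDatum T) {N : ℕ} (b : Fin (N + 1) → M)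
    (y : T.Space) : Fin N → ℝ :=
  fun i => D.theta (b i.succ) (Function.surjInv T.proj_surjective y) -
    D.theta (b 0) (Function.surjInv T.proj_surjective y)

theorem IsPolarization.affineThetaMap_proj (hD : D.IsPolarization) {N : ℕ} (b : Fin (N + 1) → M)
    (x : NR M) :
    D.affineThetaMap b (T.proj x) = fun i => D.theta (b i.succ) x - D.theta (b 0) x := by
  obtain ⟨u, hu⟩ := T.proj_eq_iff.1 (Function.surjInv_eq T.proj_surjective (T.proj x)).symm
  ext i
  rw [affineThetaMap, hu, hD.theta_add_incl, hD.theta_add_incl]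
  ring

theorem thetaMap_eq (hD : D.IsPolarization) {N : ℕ} (b : Fin (N + 1) → M) (y : T.Space) :
    thetaMap hD b y = TropicalProjectiveSpace.ofAffine (D.affineThetaMap b y) := by
  obtain ⟨x, rfl⟩ := T.proj_surjective y
  rw [hD.affineThetaMap_proj]
  refine (Quotient.sound (s := tropicalProjectiveSetoid N) ⟨D.theta (b 0) x, fun i => ?_⟩).symm
  simp only [pullback_thetaSection, ← WithTop.coe_add, WithTop.coe_inj]
  refine Fin.cases ?_ (fun j => ?_) i <;> simp

/-- A continuous injection of the compact torus into the Hausdorff space `ℝ^N` is a closed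
embedding, and `ℝ^N` embeds in projective space. -/
theorem isEmbedding_thetaMap (hD : D.IsPolarization) (hn : 0 < n) {d : Fin n → ℕ}
    (hd : D.HasType d) {N : ℕ} {b : Fin (N + 1) → M} (hb : D.IsCompleteSystem b)
    (h3 : 3 ≤ d ⟨0, hn⟩) : IsEmbedding (thetaMap hD b) := by
  obtain ⟨δ, hδ⟩ := hd.exists_div hn
  obtain ⟨-, -, e, -, -⟩ := hd
  obtain ⟨h, c, hc⟩ := hD.exists_isCentered
  have : CompactSpace T.Space := T.compactSpace e
  have hcont : Continuous (D.affineThetaMap b) := by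
    have hq : IsQuotientMap T.proj :=
      T.isOpenMap_proj.isQuotientMap T.continuous_proj T.proj_surjective
    refine hq.continuous_iff.2 ?_
    have : D.affineThetaMap b ∘ T.proj = fun x i => D.theta (b i.succ) x - D.theta (b 0) x :=
      funext fun x => hD.affineThetaMap_proj b x
    rw [this]
    exact continuous_pi fun i => (hc.continuous_theta hD e _).sub (hc.continuous_theta hD e _)
  have hinj : Function.Injective (D.affineThetaMap b) := by
    intro y y' hyy
    obtain ⟨x, rfl⟩ := T.proj_surjective y
    obtain ⟨x', rfl⟩ := T.proj_surjective y'
    rw [hD.affineThetaMap_proj, hD.affineThetaMap_proj] at hyy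
    refine hc.proj_eq_of_theta hD e hb h3 (fun u => ⟨δ u, hδ u⟩)
      (κ := D.theta (b 0) x' - D.theta (b 0) x) fun i => ?_
    refine Fin.cases (by ring) (fun j => ?_) i
    have := congrFun hyy j
    linarith
  have : thetaMap hD b = TropicalProjectiveSpace.ofAffine ∘ D.affineThetaMap b :=
    funext (thetaMap_eq hD b)
  rw [this]
  exact (TropicalProjectiveSpace.isOpenEmbedding_ofAffine N).isEmbedding.comp
    (hcont.isClosedEmbedding hinj).isEmbedding

theorem isTropicallyUnimodular_thetaMap [Module.Free ℤ M] [Module.Finite ℤ M]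
    (hD : D.IsPolarization) (hn : 0 < n) {d : Fin n → ℕ}
    (hd : D.HasType d) {N : ℕ} {b : Fin (N + 1) → M} (hb : D.IsCompleteSystem b)
    (h2 : 2 * (n - 1).factorial ≤ d ⟨0, hn⟩) : IsTropicallyUnimodular (thetaMap hD b) := by
  obtain ⟨δ, hδ⟩ := hd.exists_div hn
  obtain ⟨hd0, -, e, B, -⟩ := hd
  obtain ⟨h, c, hc⟩ := hD.exists_isCentered
  have hspan := hc.span_sub_eq_top e hb (hd0 _) δ hδ (eq_top_of_voronoi e hD hn h2)
  refine ⟨D.affineThetaMap b, thetaMap_eq hD b,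
    {χ | χ ∈ T.canonicalAtlas ∧
      IsUnimodularOn fun y : χ.target => D.affineThetaMap b (χ.homeo.symm y)},
    RealTorus.isAtlasOf_of_subset (fun χ hχ => hχ.1) fun y => ?_, fun χ hχ => hχ.2⟩
  obtain ⟨x₀, rfl⟩ := T.proj_surjective y
  obtain ⟨V₁, hV₁, hx₁, hinj⟩ := T.exists_injOn_proj x₀
  obtain ⟨V₂, hV₂, hx₂, A, hA⟩ := hc.exists_nhds_finset hD e b x₀
  obtain ⟨r, hr, hball⟩ := Metric.isOpen_iff.1
    ((hV₁.inter hV₂).preimage (coordHomeo B).symm.continuous) (coordHomeo B x₀)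
    (by simp [hx₁, hx₂])
  -- A coordinate ball provides the convex chart domain needed for the argument with relative
  -- interior points.
  let V : Set (NR M) := coordHomeo B ⁻¹' Metric.ball (coordHomeo B x₀) r
  have hV : IsOpen V := Metric.isOpen_ball.preimage (coordHomeo B).continuous
  have hVsub : V ⊆ V₁ := fun x hx => by
    have := (hball hx).1
    rwa [Homeomorph.symm_apply_apply] at this
  have htarget : (RealTorus.chart B hV (hinj.mono hVsub)).target =
      Metric.ball (coordHomeo B x₀) r :=
    (RealTorus.target_chart B hV _).trans (image_preimage_eq _ (coordHomeo B).surjective)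
  refine ⟨RealTorus.chart B hV (hinj.mono hVsub), ⟨⟨n, B, V, hV, _, rfl⟩, ?_⟩,
    ⟨⟨x₀, Metric.mem_ball_self hr⟩, rfl⟩⟩
  have hfun : (fun y : (RealTorus.chart B hV (hinj.mono hVsub)).target => D.affineThetaMap b
      ((RealTorus.chart B hV (hinj.mono hVsub)).homeo.symm y)) = fun y i =>
      D.theta (b i.succ) ((coordHomeo B).symm y.1) - D.theta (b 0) ((coordHomeo B).symm y.1) := by
    ext1 y
    rw [RealTorus.homeo_symm_chart, hD.affineThetaMap_proj]
  rw [hfun]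
  refine hc.isUnimodularOn hD e B (htarget ▸ Metric.isOpen_ball) (htarget ▸ convex_ball _ _)
    (htarget ▸ Metric.nonempty_ball.2 hr) A (fun v hv => ?_) hspan
  exact hA _ (hball (htarget ▸ hv)).2

end TropicalDescentDatum

end TropicalAbelian

theorem mainTheorem1 {M M' : Type*} [AddCommGroup M] [Module.Free ℤ M] [Module.Finite ℤ M]
    [AddCommGroup M'] [Module.Free ℤ M'] [Module.Finite ℤ M']
    (T : TropicalAbelian.RealTorus M M') (D : TropicalAbelian.TropicalDescentDatum T)
    (hD : D.IsPolarization) {n : ℕ} (hn : 0 < n) (d : Fin n → ℕ) (hd : D.HasType d)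
    {N : ℕ} (hN : N + 1 = ∏ i, d i) (b : Fin (N + 1) → M) (hb : D.IsCompleteSystem b) :
    (3 ≤ d ⟨0, hn⟩ →
      Topology.IsEmbedding (TropicalAbelian.TropicalDescentDatum.thetaMap hD b)) ∧
    (2 * (n - 1).factorial ≤ d ⟨0, hn⟩ →
      TropicalAbelian.IsTropicallyUnimodular
        (TropicalAbelian.TropicalDescentDatum.thetaMap hD b)) ∧
    (max 3 (2 * (n - 1).factorial) ≤ d ⟨0, hn⟩ →
      TropicalAbelian.IsFaithfulEmbedding
        (TropicalAbelian.TropicalDescentDatum.thetaMap hD b)) := by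
  have h1 := TropicalAbelian.TropicalDescentDatum.isEmbedding_thetaMap hD hn hd hb
  have h2 := TropicalAbelian.TropicalDescentDatum.isTropicallyUnimodular_thetaMap hD hn hd hb
  exact ⟨h1, h2, fun h => ⟨h2 ((le_max_right _ _).trans h), h1 ((le_max_left _ _).trans h)⟩⟩
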